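/- Let $m\ge 3$, and let $\mathcal P^m$ be the space of convex polygons in $\mathbb R^2$ with exactly $m$ vertices that contain the origin in their interior, with its natural smooth structure (locally, the coordinates are the positions of the $m$ vertices). For $P\in\mathcal P^m$ let $v_1,\dots,v_m$ be its consecutive vertices (cyclic index) and let $e_1,\dots,e_m$ be the vertices of the polar polygon $P^\circ=\{y:\langle y,x\rangle\le 1\ \forall x\in P\}$, which correspond to the edges of $P$. Define $$c_1(P)=\frac12\sum_{i\sim j}\log\bigl(1-\langle e_i,v_j\rangle\bigr),$$ where $i\sim j$ means that $\langle e_i,v_j\rangle\ne 1$ and $\langle e_i,v_{j+k}\rangle=1$ for some $k\in\{-1,1\}$ (for $m=3$ each such pair is counted twice, once for each value of $k$, so that the sum always has $2m$ terms). For $x\in\operatorname{int}P$ put $c_1(P,x)=c_1(P-x)$, and let $s_\infty(P)\in\operatorname{int}P$ be the unique point at which $x\mapsto c_1(P,x)$ attains its minimum over $\operatorname{int}P$. Let $R^m$ be the regular $m$-gon centered at the origin. 1. If the functional $c_1\colon\mathcal P^m\to\mathbb R$ is stationary at $P\in\mathcal P^m$ (that is, its derivative at $P$ vanishes), then $P=g(R^m)$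 for some $g\in GL_2(\mathbb R)$. 2. Among all $P\in\mathcal P^m$ with $s_\infty(P)=0$, the functional $c_1$ attains its maximum, and it does so exactly at the linear images $g(R^m)$, $g\in GL_2(\mathbb R)$. -/

import Mathlib

/-- The Euclidean plane. -/
abbrev Plane : Type := EuclideanSpace ℝ (Fin 2)

/-- `v 0, …, v (m - 1)` are the consecutive vertices (with cyclic index; `finRotate m` is the
cyclic successor) of a convex polygon that contains the origin in its interior: any two consecutive
points span an edge of the convex hull, i.e. they lie on a line `⟪e, ·⟫ = 1` and all the other
points lie strictly on the origin's side of that line. -/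
def IsVertexCycle {m : ℕ} (v : Fin m → Plane) : Prop :=
  Function.Injective v ∧
  (0 : Plane) ∈ interior (convexHull ℝ (Set.range v)) ∧
  ∀ i : Fin m, ∃ e : Plane,
    inner ℝ e (v i) = 1 ∧ inner ℝ e (v (finRotate m i)) = 1 ∧
    ∀ j : Fin m, j ≠ i → j ≠ finRotate m i → inner ℝ e (v j) < 1

/-- The space of convex polygons with `m` vertices that contain the origin in their interior
(meaningful for `3 ≤ m`). -/
def polygons (m : ℕ) : Set (Set Plane) :=
  {P | ∃ v : Fin m → Plane, IsVertexCycle v ∧ P = convexHull ℝ (Set.range v)}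

/-- The polar (dual) body `P° = {y | ⟪y, x⟫ ≤ 1 for all x ∈ P}`. -/
def polarBody (P : Set Plane) : Set Plane :=
  {y | ∀ x ∈ P, inner ℝ y x ≤ 1}

/-- The vertices `v_j` of a polygon. -/
def vertices (P : Set Plane) : Set Plane := P.extremePoints ℝ

/-- The edges `e_i` of a polygon, identified with the vertices of the polar polygon;
the edge `e` contains the vertex `v` when `⟪e, v⟫ = 1`. -/
def dualVertices (P : Set Plane) : Set Plane := (polarBody P).extremePoints ℝ

/-- `v` and `v'` are neighbouring vertices of `P`: they are the two endpoints of an edge. -/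
def IsNeighbor (P : Set Plane) (v v' : Plane) : Prop :=
  v ∈ vertices P ∧ v' ∈ vertices P ∧ v ≠ v' ∧
    ∃ e ∈ dualVertices P, inner ℝ e v = 1 ∧ inner ℝ e v' = 1

/-- The index set of the sum over `i ∼ j`: the triples `(e_i, v_j, v_{j+k})` with `k = ± 1`
such that `⟪e_i, v_j⟫ ≠ 1` and `⟪e_i, v_{j+k}⟫ = 1`. They correspond to the flags of the polygon
(the flag being `v_j` together with the edge from `v_j` to `v_{j+k}`), so an `m`-gon has `2 m` of
them; in a triangle each pair `(e_i, v_j)` with `i ∼ j` occurs for both values of `k`. -/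
def adjacentTriples (P : Set Plane) : Set (Plane × Plane × Plane) :=
  {t | t.1 ∈ dualVertices P ∧ IsNeighbor P t.2.1 t.2.2 ∧
    inner ℝ t.1 t.2.1 ≠ (1 : ℝ) ∧ inner ℝ t.1 t.2.2 = (1 : ℝ)}

/-- `c₁(P) = ½ ∑_{i ∼ j} log (1 - ⟪e_i, v_j⟫)`. -/
noncomputable def secondTerm (P : Set Plane) : ℝ :=
  (1 / 2) * ∑ᶠ t ∈ adjacentTriples P, Real.log (1 - inner ℝ t.1 t.2.1)

/-- `c₁(P, x)`: the functional with respect to the centre `x`, that is, `c₁(P - x)`. -/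
noncomputable def secondTermAt (P : Set Plane) (x : Plane) : ℝ :=
  secondTerm ((fun p => p - x) '' P)

/-- `s = s_∞(P)`: the point `s` is the unique minimum of `x ↦ c₁(P, x)` on the interior of `P`. -/
def IsSantaloPointAtInfinity (P : Set Plane) (s : Plane) : Prop :=
  s ∈ interior P ∧ ∀ x ∈ interior P, x ≠ s → secondTermAt P s < secondTermAt P x

/-- `c₁` is stationary at the `m`-gon `P`: the space of `m`-gons is coordinatized near `P` by the
positions of the `m` vertices, and in these coordinates `c₁` is differentiable at `P` with
vanishing derivative. -/
def IsStationaryAt (m : ℕ) (P : Set Plane) : Prop :=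
  ∃ v : Fin m → Plane, IsVertexCycle v ∧ P = convexHull ℝ (Set.range v) ∧
    HasFDerivAt (fun w : Fin m → Plane => secondTerm (convexHull ℝ (Set.range w)))
      (0 : (Fin m → Plane) →L[ℝ] ℝ) v

/-- The regular `m`-gon centred at the origin (with circumradius one). -/
noncomputable def regularPolygon (m : ℕ) : Set Plane :=
  convexHull ℝ (Set.range fun k : Fin m =>
    (!₂[Real.cos (2 * Real.pi * (k : ℝ) / m), Real.sin (2 * Real.pi * (k : ℝ) / m)] : Plane))

/-- `P` is the image of the regular `m`-gon under an element of `GL₂(ℝ)`. -/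
def IsLinearImageOfRegular (m : ℕ) (P : Set Plane) : Prop :=
  ∃ g : Plane ≃ₗ[ℝ] Plane, P = g '' regularPolygon m

/-!
Let `D i` and `E i` be twice the areas of the triangles that the edges of a polygon, respectively
of its polar polygon, form with the origin. For `i ∼ j` the number `1 - ⟪e_i, v_j⟫` is a product of
some `D k` and some `E l`, and summing gives `c₁ = ∑ log D i + ∑ log E i`. Hence `c₁` is invariant
under linear maps and under polarity.

The gradient of `c₁` with respect to `v_i` is a combination of the linearly independent vectors
`e_{i-1}` and `e_i`, and all these gradients vanish only if `D` and `E` are constant. In that case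
`v_{i+1} + v_{i-1} = (2 - D E) v_i`, so the vertices are linear images of points on a circle at a
constant angular distance, and convexity only allows them to go around once: the polygon is a
linear image of the regular one.

Moving the centre to `x` changes `c₁` by `-∑ log (1 - ⟪e_i, x⟫)`, which is minimal at `0` exactly if
`∑ e_i = 0`. By polarity it remains to maximize `c₁` subject to `∑ v_i = 0`. Then the nonnegative
numbers `1 - ⟪e_i, v_j⟫` add up to `m` over `j`, so a lower bound on `c₁` bounds the products
`D k * E l` away from zero; modulo linear maps the polygon stays in a compact set, and a maximum is
attained. There all the gradients agree with a single multiplier `ξ`, and testing with the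
vertices gives `∑ ⟪ξ, v_i⟫ ^ 2 = ⟪ξ, ∑ v_i⟫ = 0`, where covectors are identified with vectors.
Thus `ξ = 0`, and the polygon is stationary.
-/

namespace CyclicPolygon

open Module Set Filter Topology

instance fact_finrank_plane : Fact (finrank ℝ Plane = 2) := ⟨finrank_euclideanSpace_fin⟩

/-- The orientation of the plane given by the standard basis. -/
noncomputable def planeOrientation : Orientation ℝ Plane (Fin 2) :=
  (EuclideanSpace.basisFun (Fin 2) ℝ).toBasis.orientation

/-- The determinant of two vectors of the plane, as a continuous bilinear form. -/
noncomputable def cross : Plane →L[ℝ] Plane →L[ℝ] ℝ := planeOrientation.areaForm'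

/-- The counterclockwise rotation by a right angle, which carries `cross` to the inner product. -/
noncomputable def quarterTurn : Plane ≃ₗᵢ[ℝ] Plane := planeOrientation.rightAngleRotation

lemma cross_eq_areaForm (a b : Plane) : cross a b = planeOrientation.areaForm a b := rfl

lemma inner_quarterTurn (a b : Plane) : inner ℝ (quarterTurn a) b = cross a b :=
  planeOrientation.inner_rightAngleRotation_left a b

lemma cross_quarterTurn (a b : Plane) : cross a (quarterTurn b) = inner ℝ a b :=
  planeOrientation.areaForm_rightAngleRotation_right a b

@[simp] lemma cross_self (a : Plane) : cross a a = 0 := planeOrientation.areaForm_apply_self a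

lemma cross_swap (a b : Plane) : cross a b = -cross b a := planeOrientation.areaForm_swap a b

lemma abs_cross_le (a b : Plane) : |cross a b| ≤ ‖a‖ * ‖b‖ := planeOrientation.abs_areaForm_le a b

lemma cross_eq_det (a b : Plane) :
    cross a b = (EuclideanSpace.basisFun (Fin 2) ℝ).toBasis.det ![a, b] := by
  rw [cross_eq_areaForm, planeOrientation.areaForm_to_volumeForm,
    planeOrientation.volumeForm_robust _ rfl]

lemma cross_eq_coord (a b : Plane) : cross a b = a 0 * b 1 - a 1 * b 0 := by
  simp only [cross_eq_det, Basis.det_apply, Matrix.det_fin_two, Basis.toMatrix_apply,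
    OrthonormalBasis.coe_toBasis_repr_apply, EuclideanSpace.basisFun_repr, Matrix.cons_val_zero,
    Matrix.cons_val_one, Matrix.cons_val_fin_one]
  ring

lemma cross_map (g : Plane →ₗ[ℝ] Plane) (a b : Plane) :
    cross (g a) (g b) = LinearMap.det g * cross a b := by
  rw [cross_eq_det, cross_eq_det, ← Basis.det_comp]
  congr 1
  ext i : 1
  fin_cases i <;> rfl

lemma cross_smul_eq (a b x : Plane) : cross a b • x = cross x b • a - cross x a • b := by
  ext i
  fin_cases i <;>
    simp only [cross_eq_coord, Fin.zero_eta, Fin.mk_one, PiLp.smul_apply, smul_eq_mul,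
      PiLp.sub_apply] <;>
    ring

lemma eq_of_cross_eq {a b x y : Plane} (hab : cross a b ≠ 0) (ha : cross x a = cross y a)
    (hb : cross x b = cross y b) : x = y := by
  refine smul_right_injective _ hab ?_
  change cross a b • x = cross a b • y
  rw [cross_smul_eq, cross_smul_eq a b y, ha, hb]

lemma eq_zero_of_forall_cross_eq_zero {a : Plane} (h : ∀ b, cross a b = 0) : a = 0 := by
  simpa [cross_quarterTurn] using h (quarterTurn a)

lemma sum_cross_single {ι : Type*} [Fintype ι] [DecidableEq ι] (X : ι → Plane) (i : ι) (x : Plane) :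
    ∑ k, cross ((Pi.single i x : ι → Plane) k) (X k) = cross x (X i) := by
  rw [Finset.sum_eq_single i (fun k _ hk => by simp [hk]) (by simp), Pi.single_eq_same]

lemma eq_zero_of_forall_sum_cross_eq_zero {ι : Type*} [Fintype ι] {X : ι → Plane}
    (h : ∀ δ : ι → Plane, ∑ i, cross (δ i) (X i) = 0) (i : ι) : X i = 0 := by
  classical
  refine eq_zero_of_forall_cross_eq_zero fun x => ?_
  rw [cross_swap, ← sum_cross_single, h, neg_zero]

lemma eq_of_forall_sum_cross_eq_zero {ι : Type*} [Fintype ι] {X : ι → Plane}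
    (h : ∀ δ : ι → Plane, ∑ i, δ i = 0 → ∑ i, cross (δ i) (X i) = 0) (i j : ι) :
    X i = X j := by
  classical
  refine sub_eq_zero.mp (eq_zero_of_forall_cross_eq_zero fun x => ?_)
  have hx := h (Pi.single i x - Pi.single j x) (by simp)
  simp only [Pi.sub_apply, map_sub, sub_apply, Finset.sum_sub_distrib, sum_cross_single] at hx
  rw [cross_swap, map_sub, hx, neg_zero]

lemma linearIndependent_pair_of_cross_ne_zero {a b : Plane} (h : cross a b ≠ 0) :
    LinearIndependent ℝ ![a, b] := by
  refine LinearIndependent.pair_iff.mpr fun s t hst => ?_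
  have ha := congrArg (cross a) hst
  have hb := congrArg (cross b) hst
  simp only [map_add, map_smul, cross_self, smul_eq_mul, mul_zero, zero_add, add_zero,
    map_zero, mul_eq_zero, cross_swap b a, neg_eq_zero, h, or_false] at ha hb
  exact ⟨hb, ha⟩

lemma exists_linearEquiv {a b c d : Plane} (hab : cross a b ≠ 0) (hcd : cross c d ≠ 0) :
    ∃ g : Plane ≃ₗ[ℝ] Plane, g a = c ∧ g b = d := by
  have hcard : Fintype.card (Fin 2) = finrank ℝ Plane := by simp
  let e := basisOfLinearIndependentOfCardEqFinrank
    (linearIndependent_pair_of_cross_ne_zero hab) hcard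
  let e' := basisOfLinearIndependentOfCardEqFinrank
    (linearIndependent_pair_of_cross_ne_zero hcd) hcard
  refine ⟨e.equiv e' (Equiv.refl _), ?_, ?_⟩
  · simpa [e, e'] using e.equiv_apply 0 e' (Equiv.refl _)
  · simpa [e, e'] using e.equiv_apply 1 e' (Equiv.refl _)

/-- Twice the signed area of the triangle with vertices `a`, `b`, `c`. -/
noncomputable def triArea (a b c : Plane) : ℝ := cross a b + cross b c + cross c a

lemma triArea_map (g : Plane →ₗ[ℝ] Plane) (a b c : Plane) :
    triArea (g a) (g b) (g c) = LinearMap.det g * triArea a b c := by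
  simp only [triArea, cross_map]
  ring

lemma triArea_sub (a b c x : Plane) : triArea (a - x) (b - x) (c - x) = triArea a b c := by
  simp only [triArea, cross_eq_coord, PiLp.sub_apply]
  ring

/-! ### Polygons as cycles of vertices -/

section Cycle

variable {m : ℕ} [NeZero m]

lemma one_ne_zero_of_three_le (hm : 3 ≤ m) : (1 : Fin m) ≠ 0 := by
  obtain ⟨n, rfl⟩ := Nat.exists_eq_add_of_le' hm
  simp

lemma one_add_one_ne_zero_of_three_le (hm : 3 ≤ m) : (1 + 1 : Fin m) ≠ 0 := by
  obtain ⟨n, rfl⟩ := Nat.exists_eq_add_of_le' hm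
  simp [Fin.ext_iff, Fin.val_add, Nat.mod_eq_of_lt]

lemma succ_ne (hm : 3 ≤ m) (i : Fin m) : i + 1 ≠ i := fun h =>
  one_ne_zero_of_three_le hm (add_eq_left.mp h)

lemma pred_ne (hm : 3 ≤ m) (i : Fin m) : i - 1 ≠ i := fun h =>
  one_ne_zero_of_three_le hm (sub_eq_self.mp h)

lemma pred_ne_succ (hm : 3 ≤ m) (i : Fin m) : i - 1 ≠ i + 1 := fun h =>
  one_add_one_ne_zero_of_three_le hm (add_eq_left.mp (by rw [← add_assoc, ← h, sub_add_cancel]))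

lemma sum_succ {M : Type*} [AddCommMonoid M] (a : Fin m → M) : ∑ i, a (i + 1) = ∑ i, a i :=
  Equiv.sum_comp (Equiv.addRight 1) a

lemma sum_pred {M : Type*} [AddCommMonoid M] (a : Fin m → M) : ∑ i, a (i - 1) = ∑ i, a i :=
  Equiv.sum_comp (Equiv.subRight 1) a

lemma ofNat_succ (n : ℕ) : Fin.ofNat m (n + 1) = Fin.ofNat m n + 1 := by
  ext
  simp [Fin.val_add]

lemma ofNat_one : Fin.ofNat m 1 = 1 := by
  rw [ofNat_succ, Fin.ofNat_zero, zero_add]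

lemma eq_apply_zero_of_forall_succ_eq {α : Type*} {a : Fin m → α} (h : ∀ i, a (i + 1) = a i)
    (i : Fin m) : a i = a 0 := by
  have hn : ∀ n : ℕ, a (Fin.ofNat m n) = a 0 := fun n => by
    induction n with
    | zero => rfl
    | succ n ih => rw [ofNat_succ, h, ih]
  simpa only [Fin.ofNat_val_eq_self] using hn i.val

/-- Twice the signed area of the triangle formed by the origin and the edge from `v i` to
`v (i + 1)`. -/
noncomputable def edgeArea (v : Fin m → Plane) (i : Fin m) : ℝ := cross (v i) (v (i + 1))

/-- Twice the signed area of the triangle formed by the vertex `v i` and its two neighbours. -/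
noncomputable def cornerArea (v : Fin m → Plane) (i : Fin m) : ℝ :=
  triArea (v (i - 1)) (v i) (v (i + 1))

/-- The vertex of the polar polygon that corresponds to the edge from `v i` to `v (i + 1)`, turned
clockwise by a right angle, so that the line through this edge is `cross (polarCycle v i) x = 1`
(junk value `0` if this line contains the origin). -/
noncomputable def polarCycle (v : Fin m → Plane) (i : Fin m) : Plane :=
  (edgeArea v i)⁻¹ • (v i - v (i + 1))

/-- Twice the signed area of the triangle formed by the origin and the edge of the polar polygon
that corresponds to the vertex `v i`. -/
noncomputable def polarArea (v : Fin m → Plane) (i : Fin m) : ℝ :=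
  cross (polarCycle v (i - 1)) (polarCycle v i)

variable {v : Fin m → Plane} {i : Fin m}

lemma edgeArea_smul_polarCycle (hi : edgeArea v i ≠ 0) :
    edgeArea v i • polarCycle v i = v i - v (i + 1) :=
  smul_inv_smul₀ hi _

lemma apply_succ_eq_sub_smul (hi : edgeArea v i ≠ 0) :
    v (i + 1) = v i - edgeArea v i • polarCycle v i := by
  rw [edgeArea_smul_polarCycle hi, sub_sub_cancel]

lemma apply_pred_eq_add_smul (hi : edgeArea v (i - 1) ≠ 0) :
    v (i - 1) = v i + edgeArea v (i - 1) • polarCycle v (i - 1) := by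
  rw [edgeArea_smul_polarCycle hi, sub_add_cancel, add_sub_cancel]

lemma edgeArea_mul_one_sub_cross (hi : edgeArea v i ≠ 0) (x : Plane) :
    edgeArea v i * (1 - cross (polarCycle v i) x) = triArea (v i) (v (i + 1)) x := by
  have h : edgeArea v i * cross (polarCycle v i) x = cross (v i) x - cross (v (i + 1)) x := by
    rw [← smul_eq_mul, ← smul_apply, ← map_smul, edgeArea_smul_polarCycle hi,
      map_sub, sub_apply]
  rw [mul_sub, h, mul_one, triArea, edgeArea, cross_swap x]
  ring

lemma cross_polarCycle_self (hi : edgeArea v i ≠ 0) : cross (polarCycle v i) (v i) = 1 := by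
  have h := edgeArea_mul_one_sub_cross hi (v i)
  rw [triArea, cross_swap (v (i + 1)), cross_self, add_zero, add_neg_cancel, mul_eq_zero] at h
  linarith [h.resolve_left hi]

lemma cross_polarCycle_succ (hi : edgeArea v i ≠ 0) :
    cross (polarCycle v i) (v (i + 1)) = 1 := by
  have h := edgeArea_mul_one_sub_cross hi (v (i + 1))
  rw [triArea, cross_swap (v (i + 1)) (v i), cross_self, add_zero, add_neg_cancel, mul_eq_zero] at h
  linarith [h.resolve_left hi]

lemma cross_polarCycle_pred (hi : edgeArea v (i - 1) ≠ 0) :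
    cross (polarCycle v (i - 1)) (v i) = 1 := by
  simpa using cross_polarCycle_succ hi

lemma polarCycle_eq_add_smul (hi : edgeArea v i ≠ 0) (hi' : edgeArea v (i - 1) ≠ 0) :
    polarCycle v i = polarCycle v (i - 1) + polarArea v i • v i := by
  rw [polarArea, cross_smul_eq, cross_swap (v i), cross_swap (v i), cross_polarCycle_self hi,
    cross_polarCycle_pred hi']
  module

lemma one_sub_cross_polarCycle_pred (hi : edgeArea v i ≠ 0) (hi' : edgeArea v (i - 1) ≠ 0) :
    1 - cross (polarCycle v i) (v (i - 1)) = edgeArea v (i - 1) * polarArea v i := by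
  rw [apply_pred_eq_add_smul hi', map_add, map_smul, cross_polarCycle_self hi, polarArea,
    cross_swap (polarCycle v i), smul_eq_mul]
  ring

lemma one_sub_cross_polarCycle_succ (hi : edgeArea v i ≠ 0) (hi' : edgeArea v (i - 1) ≠ 0) :
    1 - cross (polarCycle v (i - 1)) (v (i + 1)) = edgeArea v i * polarArea v i := by
  rw [apply_succ_eq_sub_smul hi, map_sub, map_smul, cross_polarCycle_pred hi', polarArea,
    smul_eq_mul]
  ring

lemma cornerArea_eq_mul (hi : edgeArea v i ≠ 0) (hi' : edgeArea v (i - 1) ≠ 0) :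
    cornerArea v i = edgeArea v (i - 1) * (edgeArea v i * polarArea v i) := by
  rw [← one_sub_cross_polarCycle_succ hi hi', edgeArea_mul_one_sub_cross hi', sub_add_cancel,
    cornerArea]

lemma edgeArea_polarCycle_pred (v : Fin m → Plane) (i : Fin m) :
    edgeArea (polarCycle v) (i - 1) = polarArea v i := by
  rw [edgeArea, polarArea, sub_add_cancel]

lemma polarCycle_polarCycle_pred (hi : edgeArea v i ≠ 0) (hi' : edgeArea v (i - 1) ≠ 0)
    (h : polarArea v i ≠ 0) : polarCycle (polarCycle v) (i - 1) = -v i := by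
  rw [polarCycle, edgeArea_polarCycle_pred, sub_add_cancel, polarCycle_eq_add_smul hi hi',
    sub_add_cancel_left, smul_neg, inv_smul_smul₀ h]

variable (v) in
/-- `v` runs, in one of the two orientations, through the vertices of a convex polygon that
contains the origin in its interior: each further vertex lies on the same side of the line through
an edge as the origin. -/
structure IsConvexCycle : Prop where
  three_le : 3 ≤ m
  pos : ∀ i j, j ≠ i → j ≠ i + 1 → 0 < edgeArea v i * triArea (v i) (v (i + 1)) (v j)

namespace IsConvexCycle

lemma of_cross_lt (hm : 3 ≤ m) (hv : ∀ i, edgeArea v i ≠ 0)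
    (hlt : ∀ i j, j ≠ i → j ≠ i + 1 → cross (polarCycle v i) (v j) < 1) : IsConvexCycle v where
  three_le := hm
  pos i j h h' := by
    rw [← edgeArea_mul_one_sub_cross (hv i), ← mul_assoc]
    exact mul_pos (mul_self_pos.mpr (hv i)) (sub_pos.mpr (hlt i j h h'))

lemma edgeArea_ne (h : IsConvexCycle v) (i : Fin m) : edgeArea v i ≠ 0 :=
  left_ne_zero_of_mul (h.pos i (i - 1) (pred_ne h.three_le i) (pred_ne_succ h.three_le i)).ne'

lemma cross_lt (h : IsConvexCycle v) {i j : Fin m} (hj : j ≠ i) (hj' : j ≠ i + 1) :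
    cross (polarCycle v i) (v j) < 1 := by
  have hpos := h.pos i j hj hj'
  rw [← edgeArea_mul_one_sub_cross (h.edgeArea_ne i), ← mul_assoc] at hpos
  exact sub_pos.mp (pos_of_mul_pos_right hpos (mul_self_nonneg _))

lemma cross_eq_one_iff (h : IsConvexCycle v) {i j : Fin m} :
    cross (polarCycle v i) (v j) = 1 ↔ j = i ∨ j = i + 1 := by
  refine ⟨fun h1 => ?_, ?_⟩
  · by_contra! hj
    exact (h.cross_lt hj.1 hj.2).ne h1
  · rintro (rfl | rfl)
    · exact cross_polarCycle_self (h.edgeArea_ne _)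
    · exact cross_polarCycle_succ (h.edgeArea_ne _)

lemma cross_le (h : IsConvexCycle v) (i j : Fin m) : cross (polarCycle v i) (v j) ≤ 1 := by
  by_cases hj : j = i ∨ j = i + 1
  · exact (h.cross_eq_one_iff.mpr hj).le
  · exact (h.cross_lt (not_or.mp hj).1 (not_or.mp hj).2).le

lemma edgeArea_pred_mul_polarArea_pos (h : IsConvexCycle v) (i : Fin m) :
    0 < edgeArea v (i - 1) * polarArea v i := by
  rw [← one_sub_cross_polarCycle_pred (h.edgeArea_ne i) (h.edgeArea_ne _), sub_pos]
  exact h.cross_lt (pred_ne h.three_le i) (pred_ne_succ h.three_le i)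

lemma edgeArea_mul_polarArea_pos (h : IsConvexCycle v) (i : Fin m) :
    0 < edgeArea v i * polarArea v i := by
  rw [← one_sub_cross_polarCycle_succ (h.edgeArea_ne i) (h.edgeArea_ne _), sub_pos]
  refine h.cross_lt (pred_ne_succ h.three_le i).symm ?_
  rw [sub_add_cancel]
  exact succ_ne h.three_le i

lemma polarArea_ne (h : IsConvexCycle v) (i : Fin m) : polarArea v i ≠ 0 :=
  right_ne_zero_of_mul (h.edgeArea_mul_polarArea_pos i).ne'

lemma cornerArea_ne (h : IsConvexCycle v) (i : Fin m) : cornerArea v i ≠ 0 := by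
  rw [cornerArea_eq_mul (h.edgeArea_ne i) (h.edgeArea_ne _)]
  exact mul_ne_zero (h.edgeArea_ne _) (h.edgeArea_mul_polarArea_pos i).ne'

lemma injective (h : IsConvexCycle v) : Function.Injective v := by
  intro i j hij
  have h1 := cross_polarCycle_self (h.edgeArea_ne i)
  have h2 := cross_polarCycle_pred (h.edgeArea_ne (i - 1))
  rw [hij, h.cross_eq_one_iff] at h1 h2
  rw [sub_add_cancel] at h2
  rcases h2 with rfl | rfl
  · exact (h1.elim (pred_ne h.three_le i) (pred_ne_succ h.three_le i)).elim
  · rfl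

lemma polarCycle_polarCycle (h : IsConvexCycle v) (i : Fin m) :
    polarCycle (polarCycle v) i = -v (i + 1) := by
  simpa using polarCycle_polarCycle_pred (h.edgeArea_ne (i + 1)) (h.edgeArea_ne _)
    (h.polarArea_ne (i + 1))

lemma polar (h : IsConvexCycle v) : IsConvexCycle (polarCycle v) := by
  refine of_cross_lt h.three_le (fun i => ?_) fun i j hj hj' => ?_
  · rw [← add_sub_cancel_right i 1, edgeArea_polarCycle_pred]
    exact h.polarArea_ne _
  · rw [h.polarCycle_polarCycle, map_neg, neg_apply, ← cross_swap]
    exact h.cross_lt hj'.symm fun hij => hj (add_right_cancel hij).symm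

lemma polarArea_polarCycle (h : IsConvexCycle v) (i : Fin m) :
    polarArea (polarCycle v) i = edgeArea v i := by
  simp [polarArea, edgeArea, h.polarCycle_polarCycle]

end IsConvexCycle

/-! ### Faces of a polygon -/

lemma mem_extremePoints_of_cross_le {S : Set Plane} {f g x : Plane} (hfg : cross f g ≠ 0)
    (hf : ∀ y ∈ S, cross f y ≤ 1) (hg : ∀ y ∈ S, cross g y ≤ 1) (hx : x ∈ S)
    (hfx : cross f x = 1) (hgx : cross g x = 1) : x ∈ S.extremePoints ℝ := by
  refine exposedPoints_subset_extremePoints ⟨hx, cross f + cross g, fun y hy => ?_⟩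
  simp only [add_apply, hfx, hgx]
  refine ⟨add_le_add (hf y hy) (hg y hy), fun hle => ?_⟩
  have hfy : cross f y = 1 := by linarith [hf y hy, hg y hy]
  have hgy : cross g y = 1 := by linarith [hf y hy, hg y hy]
  apply eq_of_cross_eq hfg
  · rw [cross_swap, cross_swap x, hfx, hfy]
  · rw [cross_swap, cross_swap x, hgx, hgy]

lemma eq_polarCycle_of_cross_eq_one (hi : edgeArea v i ≠ 0) {f : Plane}
    (hf : cross f (v i) = 1) (hf' : cross f (v (i + 1)) = 1) : f = polarCycle v i :=
  eq_of_cross_eq hi (hf.trans (cross_polarCycle_self hi).symm)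
    (hf'.trans (cross_polarCycle_succ hi).symm)

namespace IsConvexCycle

lemma exists_eq_smul_add_smul (h : IsConvexCycle v) (x : Plane) :
    ∃ i, ∃ a b : ℝ, 0 ≤ a ∧ 0 ≤ b ∧ a + b = cross (polarCycle v i) x ∧
      x = a • v i + b • v (i + 1) := by
  obtain ⟨i, hmax⟩ := Finite.exists_max fun i => cross (polarCycle v i) x
  have hD := h.edgeArea_ne i
  have hnext : 0 ≤ cross x (v (i + 1)) * polarArea v (i + 1) := by
    have hle := hmax (i + 1)
    rw [polarCycle_eq_add_smul (h.edgeArea_ne _) (h.edgeArea_ne _), add_sub_cancel_right, map_add,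
      map_smul, add_apply, smul_apply, smul_eq_mul] at hle
    rw [cross_swap x]
    linarith
  have hprev : 0 ≤ cross (v i) x * polarArea v i := by
    have hle := hmax (i - 1)
    rw [polarCycle_eq_add_smul (h.edgeArea_ne i) (h.edgeArea_ne _), map_add, map_smul, add_apply,
      smul_apply, smul_eq_mul] at hle
    linarith
  have hpos : 0 < edgeArea v i * polarArea v (i + 1) := by
    simpa using h.edgeArea_pred_mul_polarArea_pos (i + 1)
  refine ⟨i, cross x (v (i + 1)) / edgeArea v i, cross (v i) x / edgeArea v i, ?_, ?_, ?_, ?_⟩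
  · rw [← mul_div_mul_right _ _ (h.polarArea_ne (i + 1))]
    exact div_nonneg hnext hpos.le
  · rw [← mul_div_mul_right _ _ (h.polarArea_ne i)]
    exact div_nonneg hprev (h.edgeArea_mul_polarArea_pos i).le
  · rw [polarCycle, map_smul, map_sub, smul_apply, sub_apply, smul_eq_mul, cross_swap x]
    ring
  · refine smul_right_injective _ hD ?_
    change edgeArea v i • x = edgeArea v i • _
    rw [smul_add, smul_smul, smul_smul, mul_div_cancel₀ _ hD, mul_div_cancel₀ _ hD, edgeArea,
      cross_smul_eq, cross_swap x (v i)]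
    module

lemma exists_mem_convexHull_eq_smul (h : IsConvexCycle v) (x : Plane) :
    ∃ i, ∃ p ∈ convexHull ℝ (range v), 0 ≤ cross (polarCycle v i) x ∧
      x = cross (polarCycle v i) x • p := by
  obtain ⟨i, a, b, ha, hb, hab, hx⟩ := h.exists_eq_smul_add_smul x
  have hv : ∀ j, v j ∈ convexHull ℝ (range v) := fun j => subset_convexHull _ _ ⟨j, rfl⟩
  refine ⟨i, ?_⟩
  rw [← hab]
  rcases (add_nonneg ha hb).eq_or_lt' with h0 | hpos
  · obtain ⟨rfl, rfl⟩ := (add_eq_zero_iff_of_nonneg ha hb).mp h0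
    exact ⟨v i, hv i, h0.ge, by simpa using hx⟩
  · refine ⟨_, convex_iff_div.mp (convex_convexHull ℝ _) (hv i) (hv (i + 1)) ha hb hpos,
      hpos.le, ?_⟩
    rw [smul_add, smul_smul, smul_smul, mul_div_cancel₀ _ hpos.ne', mul_div_cancel₀ _ hpos.ne']
    exact hx

lemma zero_mem_convexHull (h : IsConvexCycle v) : (0 : Plane) ∈ convexHull ℝ (range v) := by
  obtain ⟨i, p, hp, hs, hx⟩ := h.exists_mem_convexHull_eq_smul (-v 0)
  set s := cross (polarCycle v i) (-v 0)
  have hmem := convex_iff_div.mp (convex_convexHull ℝ _)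
    (subset_convexHull ℝ (range v) (mem_range_self 0)) hp zero_le_one hs (by positivity)
  rwa [div_eq_inv_mul, div_eq_inv_mul, mul_smul, mul_smul, ← hx, one_smul, smul_neg,
    add_neg_cancel] at hmem

lemma convexHull_eq (h : IsConvexCycle v) :
    convexHull ℝ (range v) = ⋂ k, cross (polarCycle v k) ⁻¹' Iic 1 := by
  refine (convexHull_min ?_ ?_).antisymm fun x hx => ?_
  · rintro _ ⟨j, rfl⟩
    exact mem_iInter.mpr fun k => h.cross_le k j
  · exact convex_iInter fun k =>
      (convex_Iic 1).is_linear_preimage (cross (polarCycle v k)).isBoundedLinearMap.toIsLinearMap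
  · obtain ⟨i, p, hp, hs, hxp⟩ := h.exists_mem_convexHull_eq_smul x
    rw [hxp]
    exact (convex_convexHull ℝ _).smul_mem_of_zero_mem h.zero_mem_convexHull hp
      ⟨hs, mem_iInter.mp hx i⟩

lemma interior_convexHull (h : IsConvexCycle v) :
    interior (convexHull ℝ (range v)) = {x | ∀ k, cross (polarCycle v k) x < 1} := by
  have hsurj : ∀ k, Function.Surjective (cross (polarCycle v k)) := fun k =>
    LinearMap.surjective (f := (cross (polarCycle v k)).toLinearMap) fun h0 =>
      zero_ne_one ((LinearMap.congr_fun h0 (v k)).symm.trans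
        (cross_polarCycle_self (h.edgeArea_ne k)))
  rw [h.convexHull_eq, interior_iInter_of_finite]
  simp only [(cross _).interior_preimage (hsurj _), interior_Iic]
  ext x
  simp only [mem_iInter, mem_preimage, mem_Iio, mem_ofPred_eq]

lemma vertices_convexHull (h : IsConvexCycle v) :
    vertices (convexHull ℝ (range v)) = range v := by
  refine extremePoints_convexHull_subset.antisymm ?_
  rintro _ ⟨i, rfl⟩
  have hle : ∀ k, ∀ y ∈ convexHull ℝ (range v), cross (polarCycle v k) y ≤ 1 := fun k y hy =>
    mem_iInter.mp (h.convexHull_eq.subset hy) k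
  exact mem_extremePoints_of_cross_le (h.polarArea_ne i) (hle _) (hle _)
    (subset_convexHull _ _ ⟨i, rfl⟩) (cross_polarCycle_pred (h.edgeArea_ne _))
    (cross_polarCycle_self (h.edgeArea_ne i))

lemma polarBody_convexHull (h : IsConvexCycle v) :
    polarBody (convexHull ℝ (range v)) =
      quarterTurn '' convexHull ℝ (range (polarCycle v)) := by
  ext y
  obtain ⟨f, rfl⟩ := quarterTurn.surjective y
  have hpolar : f ∈ convexHull ℝ (range (polarCycle v)) ↔ ∀ k, cross f (v k) ≤ 1 := by
    simp only [h.polar.convexHull_eq, h.polarCycle_polarCycle, mem_iInter, mem_preimage, mem_Iic,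
      map_neg, neg_apply, ← cross_swap]
    exact (Equiv.addRight 1).forall_congr_right (q := fun k => cross f (v k) ≤ 1)
  rw [quarterTurn.injective.mem_set_image, hpolar]
  simp only [polarBody, mem_ofPred_eq, inner_quarterTurn]
  refine ⟨fun hf k => hf _ (subset_convexHull ℝ _ ⟨k, rfl⟩), fun hf x hx => ?_⟩
  refine convexHull_min (t := cross f ⁻¹' Iic 1) (range_subset_iff.mpr hf) ?_ hx
  exact (convex_Iic 1).is_linear_preimage (cross f).isBoundedLinearMap.toIsLinearMap

lemma dualVertices_convexHull (h : IsConvexCycle v) :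
    dualVertices (convexHull ℝ (range v)) = range fun i => quarterTurn (polarCycle v i) := by
  have hvert := h.polar.vertices_convexHull
  rw [vertices] at hvert
  rw [dualVertices, h.polarBody_convexHull, ← image_extremePoints, hvert, ← range_comp]
  rfl

lemma isNeighbor_iff (h : IsConvexCycle v) {x y : Plane} :
    IsNeighbor (convexHull ℝ (range v)) x y ↔
      ∃ k, (x = v k ∧ y = v (k + 1)) ∨ (x = v (k + 1) ∧ y = v k) := by
  have hne : ∀ k, v k ≠ v (k + 1) := fun k e => succ_ne h.three_le k (h.injective e).symm
  rw [IsNeighbor, h.vertices_convexHull, h.dualVertices_convexHull]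
  constructor
  · rintro ⟨⟨a, rfl⟩, ⟨b, rfl⟩, hab, _, ⟨k, rfl⟩, ha, hb⟩
    rw [inner_quarterTurn, h.cross_eq_one_iff] at ha hb
    grind
  · rintro ⟨k, ⟨rfl, rfl⟩ | ⟨rfl, rfl⟩⟩
    · exact ⟨⟨_, rfl⟩, ⟨_, rfl⟩, hne k, _, ⟨k, rfl⟩,
        by rw [inner_quarterTurn, cross_polarCycle_self (h.edgeArea_ne k)],
        by rw [inner_quarterTurn, cross_polarCycle_succ (h.edgeArea_ne k)]⟩
    · exact ⟨⟨_, rfl⟩, ⟨_, rfl⟩, (hne k).symm, _, ⟨k, rfl⟩,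
        by rw [inner_quarterTurn, cross_polarCycle_succ (h.edgeArea_ne k)],
        by rw [inner_quarterTurn, cross_polarCycle_self (h.edgeArea_ne k)]⟩

end IsConvexCycle

lemma edgeArea_ne_zero_of_cross_eq_one (hne : v (i + 1) ≠ v i) {f : Plane}
    (hf : cross f (v i) = 1) (hf' : cross f (v (i + 1)) = 1) : edgeArea v i ≠ 0 := fun h0 => by
  refine hne (eq_of_cross_eq (a := v i) (b := f) ?_ ?_ ?_)
  · rw [cross_swap, hf]
    norm_num
  · rw [cross_self, cross_swap, ← edgeArea, h0, neg_zero]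
  · rw [cross_swap, cross_swap (v i), hf, hf']

lemma isVertexCycle_iff (hm : 3 ≤ m) : IsVertexCycle v ↔ IsConvexCycle v := by
  constructor
  · rintro ⟨hinj, -, hedge⟩
    have hcross : ∀ i, ∃ f, cross f (v i) = 1 ∧ cross f (v (i + 1)) = 1 ∧
        ∀ j, j ≠ i → j ≠ i + 1 → cross f (v j) < 1 := fun i => by
      simpa only [inner_quarterTurn, finRotate_apply] using
        quarterTurn.surjective.exists.mp (hedge i)
    have hD : ∀ i, edgeArea v i ≠ 0 := fun i =>
      have ⟨_, hf, hf', _⟩ := hcross i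
      edgeArea_ne_zero_of_cross_eq_one (hinj.ne (succ_ne hm i)) hf hf'
    refine .of_cross_lt hm hD fun i j hj hj' => ?_
    obtain ⟨f, hf, hf', hlt⟩ := hcross i
    rw [← eq_polarCycle_of_cross_eq_one (hD i) hf hf']
    exact hlt j hj hj'
  · intro h
    refine ⟨h.injective, by simp [h.interior_convexHull], fun i => ?_⟩
    refine quarterTurn.surjective.exists.mpr ⟨polarCycle v i, ?_⟩
    simp only [inner_quarterTurn, finRotate_apply]
    exact ⟨cross_polarCycle_self (h.edgeArea_ne i), cross_polarCycle_succ (h.edgeArea_ne i),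
      fun j => h.cross_lt⟩

/-! ### The functional in terms of areas -/

/-- The flags of a polygon as the triples over which `secondTerm` sums: the flag of the edge
`v (i - 1)`, `v i` at `v (i - 1)` is recorded with the next edge, that of the edge `v (i + 1)`,
`v (i + 2)` at `v (i + 2)` with the previous one. -/
noncomputable def flagTriple (v : Fin m → Plane) : Fin m ⊕ Fin m → Plane × Plane × Plane :=
  Sum.elim (fun i => (quarterTurn (polarCycle v i), v (i - 1), v i))
    (fun i => (quarterTurn (polarCycle v i), v (i + 1 + 1), v (i + 1)))

/-- The functional `c₁` in terms of the vertices of the polygon. -/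
noncomputable def areaFunctional (v : Fin m → Plane) : ℝ :=
  ∑ i, (Real.log (cornerArea v i) - Real.log (edgeArea v i))

namespace IsConvexCycle

lemma flagTriple_injective (h : IsConvexCycle v) : Function.Injective (flagTriple v) := by
  have hedge : ∀ {i j}, quarterTurn (polarCycle v i) = quarterTurn (polarCycle v j) → i = j :=
    fun e => h.polar.injective (quarterTurn.injective e)
  have hne : ∀ k, v k ≠ v (k + 1) := fun k e => succ_ne h.three_le k (h.injective e).symm
  rintro (i | i) (j | j) e <;> obtain rfl := hedge (congrArg Prod.fst e)
  · rfl
  · exact absurd (congrArg (·.2.2) e) (hne i)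
  · exact absurd (congrArg (·.2.2) e).symm (hne i)
  · rfl

lemma adjacentTriples_convexHull (h : IsConvexCycle v) :
    adjacentTriples (convexHull ℝ (range v)) = range (flagTriple v) := by
  ext ⟨e, x, y⟩
  simp only [adjacentTriples, mem_ofPred_eq, h.isNeighbor_iff, h.dualVertices_convexHull]
  constructor
  · rintro ⟨⟨i, rfl⟩, ⟨k, ⟨rfl, rfl⟩ | ⟨rfl, rfl⟩⟩, hx, hy⟩ <;>
      simp only [inner_quarterTurn, ne_eq, h.cross_eq_one_iff, not_or, add_left_inj] at hx hy
    · obtain rfl := hy.resolve_right hx.1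
      exact ⟨.inl (k + 1), by simp [flagTriple]⟩
    · obtain rfl := hy.resolve_left hx.2
      exact ⟨.inr i, rfl⟩
  · rintro ⟨i | i, hi⟩ <;>
      simp only [flagTriple, Sum.elim_inl, Sum.elim_inr, Prod.mk.injEq] at hi <;>
      obtain ⟨rfl, rfl, rfl⟩ := hi
    · refine ⟨⟨i, rfl⟩, ⟨i - 1, .inl ⟨rfl, by rw [sub_add_cancel]⟩⟩, ?_, ?_⟩
      · rw [inner_quarterTurn, ne_eq, h.cross_eq_one_iff]
        exact not_or.mpr ⟨pred_ne h.three_le i, pred_ne_succ h.three_le i⟩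
      · rw [inner_quarterTurn, cross_polarCycle_self (h.edgeArea_ne i)]
    · refine ⟨⟨i, rfl⟩, ⟨i + 1, .inr ⟨rfl, rfl⟩⟩, ?_, ?_⟩
      · rw [inner_quarterTurn, ne_eq, h.cross_eq_one_iff]
        refine not_or.mpr ⟨fun e => pred_ne_succ h.three_le i ?_, succ_ne h.three_le _⟩
        rw [sub_eq_iff_eq_add, e]
      · rw [inner_quarterTurn, cross_polarCycle_succ (h.edgeArea_ne i)]

lemma areaFunctional_eq (h : IsConvexCycle v) :
    areaFunctional v = ∑ i, Real.log (edgeArea v i) + ∑ i, Real.log (polarArea v i) := by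
  have hcorner : ∀ i, Real.log (cornerArea v i) - Real.log (edgeArea v i) =
      Real.log (edgeArea v (i - 1)) + Real.log (polarArea v i) := fun i => by
    rw [cornerArea_eq_mul (h.edgeArea_ne _) (h.edgeArea_ne _), mul_left_comm,
      Real.log_mul (h.edgeArea_ne i) (h.edgeArea_pred_mul_polarArea_pos i).ne',
      Real.log_mul (h.edgeArea_ne _) (h.polarArea_ne i), add_sub_cancel_left]
  rw [areaFunctional, Finset.sum_congr rfl fun i _ => hcorner i, Finset.sum_add_distrib,
    sum_pred fun i => Real.log (edgeArea v i)]

lemma areaFunctional_polarCycle (h : IsConvexCycle v) :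
    areaFunctional (polarCycle v) = areaFunctional v := by
  rw [h.polar.areaFunctional_eq, h.areaFunctional_eq, ← sum_pred, add_comm]
  simp only [h.polarArea_polarCycle, edgeArea_polarCycle_pred]

lemma secondTerm_convexHull (h : IsConvexCycle v) :
    secondTerm (convexHull ℝ (range v)) = areaFunctional v := by
  have hpred : ∀ i, Real.log (1 - cross (polarCycle v i) (v (i - 1))) =
      Real.log (edgeArea v (i - 1)) + Real.log (polarArea v i) := fun i => by
    rw [one_sub_cross_polarCycle_pred (h.edgeArea_ne _) (h.edgeArea_ne _),
      Real.log_mul (h.edgeArea_ne _) (h.polarArea_ne i)]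
  have hsucc : ∀ i, Real.log (1 - cross (polarCycle v i) (v (i + 1 + 1))) =
      Real.log (edgeArea v (i + 1)) + Real.log (polarArea v (i + 1)) := fun i => by
    rw [← Real.log_mul (h.edgeArea_ne _) (h.polarArea_ne _),
      ← one_sub_cross_polarCycle_succ (h.edgeArea_ne _) (h.edgeArea_ne _), add_sub_cancel_right]
  rw [secondTerm, h.adjacentTriples_convexHull, finsum_mem_range h.flagTriple_injective,
    finsum_eq_sum_of_fintype, Fintype.sum_sum_type, h.areaFunctional_eq]
  simp only [flagTriple, Sum.elim_inl, Sum.elim_inr, inner_quarterTurn, hpred, hsucc]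
  rw [Finset.sum_add_distrib, sum_pred fun i => Real.log (edgeArea v i),
    sum_succ fun i => Real.log (edgeArea v i) + Real.log (polarArea v i), Finset.sum_add_distrib]
  ring

end IsConvexCycle

/-! ### Stationary polygons -/

/-- The gradient of `areaFunctional` with respect to the vertex `v i`, where covectors are written
as `fun x => cross x G`. -/
noncomputable def areaGradient (v : Fin m → Plane) (i : Fin m) : Plane :=
  ((edgeArea v i * polarArea v (i + 1))⁻¹ - (edgeArea v (i - 1) * polarArea v i)⁻¹) •
      polarCycle v i +
    ((edgeArea v (i - 1) * polarArea v (i - 1))⁻¹ - (edgeArea v i * polarArea v i)⁻¹) •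
      polarCycle v (i - 1)

lemma hasDerivAt_cross (a b x y : Plane) :
    HasDerivAt (fun t : ℝ => cross (a + t • x) (b + t • y)) (cross x b + cross a y) 0 := by
  have hline : ∀ a x : Plane, HasDerivAt (fun t : ℝ => a + t • x) x 0 := fun a x => by
    simpa using ((hasDerivAt_id (0 : ℝ)).smul_const x).const_add a
  simpa [add_comm] using
    cross.hasDerivAt_of_bilinear (fun _ => hline a x) fun _ => hline b y

lemma sum_mul_sub_succ (a b : Fin m → ℝ) :
    ∑ i, a i * (b i - b (i + 1)) = ∑ i, (a i - a (i - 1)) * b i := by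
  have hshift := sum_pred fun i => a i * b (i + 1)
  simp only [sub_add_cancel] at hshift
  simp only [mul_sub, sub_mul, Finset.sum_sub_distrib, hshift]

lemma eq_of_forall_mul_succ_eq {a b : ℝ} {x : Fin m → ℝ} (ha : 0 ≤ a) (hb : 0 ≤ b) (hx : x ≠ 0)
    (h : ∀ i, a * x (i + 1) = b * x i) : a = b := by
  obtain ⟨i, hi⟩ := Function.ne_iff.mp hx
  have hpos : 0 < ∑ i, x i ^ 2 :=
    Finset.sum_pos' (fun i _ => sq_nonneg _) ⟨i, Finset.mem_univ i, sq_pos_of_ne_zero hi⟩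
  have hsum : a ^ 2 * ∑ i, x i ^ 2 = b ^ 2 * ∑ i, x i ^ 2 := by
    rw [← sum_succ, Finset.mul_sum, sum_succ fun i => x i ^ 2, Finset.mul_sum]
    exact Finset.sum_congr rfl fun i _ => by rw [← mul_pow, h, mul_pow]
  exact (pow_left_inj₀ ha hb two_ne_zero).mp (mul_right_cancel₀ hpos.ne' hsum)

variable (v) in
/-- The triangles that the edges of the polygon form with the origin have the same area, and so do
those of the polar polygon. -/
def IsEquiareal : Prop := (∃ D, ∀ i, edgeArea v i = D) ∧ ∃ E, ∀ i, polarArea v i = E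

namespace IsConvexCycle

lemma hasDerivAt_log_edgeArea (h : IsConvexCycle v) (δ : Fin m → Plane) (i : Fin m) :
    HasDerivAt (fun t : ℝ => Real.log (edgeArea (v + t • δ) i))
      ((edgeArea v i)⁻¹ * (cross (δ i) (v (i + 1)) - cross (δ (i + 1)) (v i))) 0 := by
  have hedge : HasDerivAt (fun t : ℝ => edgeArea (v + t • δ) i)
      (cross (δ i) (v (i + 1)) + cross (v i) (δ (i + 1))) 0 := hasDerivAt_cross _ _ _ _
  convert hedge.log (by simpa using h.edgeArea_ne i) using 1
  rw [zero_smul, add_zero, cross_swap (v i)]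
  ring

lemma hasDerivAt_log_cornerArea (h : IsConvexCycle v) (δ : Fin m → Plane) (i : Fin m) :
    HasDerivAt (fun t : ℝ => Real.log (cornerArea (v + t • δ) i))
      ((edgeArea v (i - 1) * polarArea v i)⁻¹ * cross (δ (i - 1) - δ i) (polarCycle v i) +
        (edgeArea v i * polarArea v i)⁻¹ * cross (δ (i + 1) - δ i) (polarCycle v (i - 1))) 0 := by
  have hcorner : HasDerivAt (fun t : ℝ => cornerArea (v + t • δ) i) _ 0 :=
    ((hasDerivAt_cross (v (i - 1)) (v i) (δ (i - 1)) (δ i)).add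
      (hasDerivAt_cross (v i) (v (i + 1)) (δ i) (δ (i + 1)))).add
      (hasDerivAt_cross (v (i + 1)) (v (i - 1)) (δ (i + 1)) (δ (i - 1)))
  convert hcorner.log (by simpa using h.cornerArea_ne i) using 1
  have hi := h.edgeArea_ne i
  have hi' := h.edgeArea_ne (i - 1)
  have hp := h.polarArea_ne i
  rw [zero_smul, add_zero, cornerArea_eq_mul hi hi', apply_succ_eq_sub_smul hi,
    apply_pred_eq_add_smul hi', cross_swap _ (δ i), cross_swap _ (δ (i + 1)),
    cross_swap _ (δ (i - 1))]
  simp only [map_add, map_sub, map_smul, sub_apply, smul_eq_mul]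
  field_simp
  ring

lemma areaGradient_eq (h : IsConvexCycle v) (i : Fin m) :
    areaGradient v i =
      ((edgeArea v i * polarArea v (i + 1))⁻¹ • polarCycle v (i + 1) -
        (edgeArea v i)⁻¹ • v (i + 1) - (edgeArea v (i - 1) * polarArea v i)⁻¹ • polarCycle v i) +
      ((edgeArea v (i - 1) * polarArea v (i - 1))⁻¹ • polarCycle v (i - 1 - 1) +
        (edgeArea v (i - 1))⁻¹ • v (i - 1) -
        (edgeArea v i * polarArea v i)⁻¹ • polarCycle v (i - 1)) := by
  have hcancel : ∀ i j, (edgeArea v i * polarArea v j)⁻¹ * polarArea v j = (edgeArea v i)⁻¹ :=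
    fun i j => by rw [mul_inv, inv_mul_cancel_right₀ (h.polarArea_ne j)]
  rw [polarCycle_eq_add_smul (h.edgeArea_ne (i + 1)) (h.edgeArea_ne _), add_sub_cancel_right,
    eq_sub_of_add_eq (polarCycle_eq_add_smul (h.edgeArea_ne (i - 1)) (h.edgeArea_ne _)).symm,
    smul_add, smul_sub, smul_smul, smul_smul, hcancel, hcancel, areaGradient]
  module

lemma hasDerivAt_areaFunctional (h : IsConvexCycle v) (δ : Fin m → Plane) :
    HasDerivAt (fun t : ℝ => areaFunctional (v + t • δ)) (∑ i, cross (δ i) (areaGradient v i))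
      0 := by
  refine (HasDerivAt.fun_sum fun i _ =>
    (h.hasDerivAt_log_cornerArea δ i).sub (h.hasDerivAt_log_edgeArea δ i)).congr_deriv ?_
  have h1 := sum_pred fun i =>
    (edgeArea v i * polarArea v (i + 1))⁻¹ * cross (δ i) (polarCycle v (i + 1))
  have h2 := sum_succ fun i => (edgeArea v (i - 1) * polarArea v (i - 1))⁻¹ *
    cross (δ i) (polarCycle v (i - 1 - 1))
  have h3 := sum_succ fun i => (edgeArea v (i - 1))⁻¹ * cross (δ i) (v (i - 1))
  simp only [sub_add_cancel, add_sub_cancel_right] at h1 h2 h3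
  simp only [h.areaGradient_eq, map_add, map_sub, map_smul, sub_apply, smul_eq_mul, mul_sub,
    Finset.sum_add_distrib, Finset.sum_sub_distrib, h1, h2, h3]
  ring

lemma areaGradient_eq_zero_iff (h : IsConvexCycle v) :
    areaGradient v i = 0 ↔
      edgeArea v i * polarArea v (i + 1) = edgeArea v (i - 1) * polarArea v i ∧
      edgeArea v i * polarArea v i = edgeArea v (i - 1) * polarArea v (i - 1) := by
  have hindep := LinearIndependent.pair_iff.mp
    (linearIndependent_pair_of_cross_ne_zero (h.polarArea_ne i))
  refine ⟨fun h0 => ?_, fun ⟨h1, h2⟩ => ?_⟩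
  · obtain ⟨h2, h1⟩ := hindep _ _ ((add_comm _ _).trans h0)
    exact ⟨inv_injective (sub_eq_zero.mp h1), (inv_injective (sub_eq_zero.mp h2)).symm⟩
  · rw [areaGradient, h1, h2, sub_self, sub_self, zero_smul, zero_smul, add_zero]

lemma isEquiareal_of_areaGradient_eq_zero (h : IsConvexCycle v)
    (h0 : ∀ i, areaGradient v i = 0) : IsEquiareal v := by
  have hcrit := fun i => h.areaGradient_eq_zero_iff.mp (h0 (i + 1))
  simp only [add_sub_cancel_right] at hcrit
  have ha := eq_apply_zero_of_forall_succ_eq (a := fun i => edgeArea v i * polarArea v i)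
    fun i => (hcrit i).2
  have hb := eq_apply_zero_of_forall_succ_eq (a := fun i => edgeArea v i * polarArea v (i + 1))
    fun i => (hcrit i).1
  have hapos := h.edgeArea_mul_polarArea_pos 0
  have hbpos := h.edgeArea_pred_mul_polarArea_pos (0 + 1)
  rw [add_sub_cancel_right] at hbpos
  have hab := eq_of_forall_mul_succ_eq hapos.le hbpos.le
    (Function.ne_iff.mpr ⟨0, h.polarArea_ne 0⟩) fun i => by
      rw [← ha i, ← hb i]
      ring
  have hE := eq_apply_zero_of_forall_succ_eq fun i => mul_left_cancel₀ (h.edgeArea_ne i)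
    ((hb i).trans (hab.symm.trans (ha i).symm))
  exact ⟨⟨_, fun i => mul_right_cancel₀ (h.polarArea_ne 0) (hE i ▸ ha i)⟩, _, hE⟩

lemma cross_areaGradient (h : IsConvexCycle v) (i : Fin m) :
    cross (v i) (areaGradient v i) =
      ((edgeArea v i * polarArea v i)⁻¹ - (edgeArea v i * polarArea v (i + 1))⁻¹) -
      ((edgeArea v (i - 1) * polarArea v (i - 1))⁻¹ -
        (edgeArea v (i - 1) * polarArea v (i - 1 + 1))⁻¹) := by
  rw [areaGradient, map_add, map_smul, map_smul, cross_swap, cross_swap _ (polarCycle v (i - 1)),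
    cross_polarCycle_self (h.edgeArea_ne i), cross_polarCycle_pred (h.edgeArea_ne _),
    sub_add_cancel]
  simp only [smul_eq_mul]
  ring

lemma sum_mul_cross_sub_succ (h : IsConvexCycle v) (ξ : Plane) :
    ∑ i, ((edgeArea v i * polarArea v i)⁻¹ - (edgeArea v i * polarArea v (i + 1))⁻¹) *
      (cross (v i) ξ - cross (v (i + 1)) ξ) = cross (∑ i, v i) ξ := by
  have hedge : ∀ i, ((edgeArea v i * polarArea v i)⁻¹ - (edgeArea v i * polarArea v (i + 1))⁻¹) *
      (cross (v i) ξ - cross (v (i + 1)) ξ) =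
      cross (polarCycle v i) ξ * ((polarArea v i)⁻¹ - (polarArea v (i + 1))⁻¹) := fun i => by
    rw [← sub_apply, ← map_sub, ← edgeArea_smul_polarCycle (h.edgeArea_ne i), map_smul,
      smul_apply, smul_eq_mul, mul_inv, mul_inv, ← mul_sub]
    field_simp [h.edgeArea_ne i]
  have hvertex : ∀ i, (cross (polarCycle v i) ξ - cross (polarCycle v (i - 1)) ξ) *
      (polarArea v i)⁻¹ = cross (v i) ξ := fun i => by
    rw [polarCycle_eq_add_smul (h.edgeArea_ne i) (h.edgeArea_ne _), map_add, add_apply,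
      add_sub_cancel_left, map_smul, smul_apply, smul_eq_mul, mul_comm,
      inv_mul_cancel_left₀ (h.polarArea_ne i)]
  rw [Finset.sum_congr rfl fun i _ => hedge i,
    sum_mul_sub_succ (fun i => cross (polarCycle v i) ξ) fun i => (polarArea v i)⁻¹,
    Finset.sum_congr rfl fun i _ => hvertex i, map_sum, sum_apply]

lemma areaGradient_eq_zero_of_forall_eq (h : IsConvexCycle v) (hv : ∑ i, v i = 0) {ξ : Plane}
    (hξ : ∀ i, areaGradient v i = ξ) : ξ = 0 := by
  have hsq : ∑ i, cross (v i) ξ * cross (v i) ξ = 0 := by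
    have hsum := h.sum_mul_cross_sub_succ ξ
    rw [hv, map_zero, zero_apply, sum_mul_sub_succ
      (fun i => (edgeArea v i * polarArea v i)⁻¹ - (edgeArea v i * polarArea v (i + 1))⁻¹)
      fun i => cross (v i) ξ] at hsum
    rw [← hsum]
    exact Finset.sum_congr rfl fun i _ => by rw [← h.cross_areaGradient, hξ]
  have hzero : ∀ i, cross ξ (v i) = 0 := fun i => by
    rw [cross_swap, neg_eq_zero, ← mul_self_eq_zero]
    exact (Finset.sum_eq_zero_iff_of_nonneg fun i _ => mul_self_nonneg _).mp hsq i
      (Finset.mem_univ i)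
  refine eq_of_cross_eq (h.edgeArea_ne 0) ?_ ?_ <;> rw [hzero, map_zero, zero_apply]

lemma eventually_nhds (h : IsConvexCycle v) : ∀ᶠ w in 𝓝 v, IsConvexCycle w := by
  have hpos : ∀ i j, ∀ᶠ w in 𝓝 v, j ≠ i → j ≠ i + 1 →
      0 < edgeArea w i * triArea (w i) (w (i + 1)) (w j) := fun i j => by
    by_cases hj : j ≠ i ∧ j ≠ i + 1
    · have hcont : Continuous fun w : Fin m → Plane =>
          edgeArea w i * triArea (w i) (w (i + 1)) (w j) := by
        unfold edgeArea triArea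
        fun_prop
      filter_upwards [hcont.continuousAt.eventually_const_lt (h.pos i j hj.1 hj.2)] with w hw _ _
      exact hw
    · exact .of_forall fun w h1 h2 => absurd ⟨h1, h2⟩ hj
  filter_upwards [eventually_all.mpr fun i => eventually_all.mpr fun j => hpos i j] with w hw
  exact ⟨h.three_le, hw⟩

lemma isEquiareal_of_hasFDerivAt (h : IsConvexCycle v)
    (hd : HasFDerivAt (fun w : Fin m → Plane => secondTerm (convexHull ℝ (range w)))
      (0 : (Fin m → Plane) →L[ℝ] ℝ) v) : IsEquiareal v := by
  refine h.isEquiareal_of_areaGradient_eq_zero (eq_zero_of_forall_sum_cross_eq_zero fun δ => ?_)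
  have hd' : HasFDerivAt areaFunctional (0 : (Fin m → Plane) →L[ℝ] ℝ) v := by
    refine hd.congr_of_eventuallyEq ?_
    filter_upwards [h.eventually_nhds] with w hw
    exact hw.secondTerm_convexHull.symm
  exact (h.hasDerivAt_areaFunctional δ).unique (hd'.hasLineDerivAt δ)

lemma isEquiareal_of_forall_areaFunctional_le (h : IsConvexCycle v) (hv : ∑ i, v i = 0)
    (hmax : ∀ w : Fin m → Plane, IsConvexCycle w → ∑ i, w i = 0 →
      areaFunctional w ≤ areaFunctional v) : IsEquiareal v := by
  have hconst : ∀ i, areaGradient v i = areaGradient v 0 := fun i => by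
    refine eq_of_forall_sum_cross_eq_zero (fun δ hδ => ?_) i 0
    refine IsLocalMax.hasDerivAt_eq_zero ?_ (h.hasDerivAt_areaFunctional δ)
    have hcont : ContinuousAt (fun t : ℝ => v + t • δ) 0 := by fun_prop
    have hconvex : ∀ᶠ t in 𝓝 (0 : ℝ), IsConvexCycle (v + t • δ) :=
      hcont.eventually (by simpa using h.eventually_nhds)
    filter_upwards [hconvex] with t ht
    rw [zero_smul, add_zero]
    exact hmax _ ht (by simp [Finset.sum_add_distrib, hv, ← Finset.smul_sum, hδ])
  refine h.isEquiareal_of_areaGradient_eq_zero fun i => ?_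
  rw [hconst, h.areaGradient_eq_zero_of_forall_eq hv hconst]

end IsConvexCycle

/-! ### Polygons with constant areas -/

lemma edgeArea_comp (g : Plane →ₗ[ℝ] Plane) (v : Fin m → Plane) (i : Fin m) :
    edgeArea (g ∘ v) i = LinearMap.det g * edgeArea v i :=
  cross_map g _ _

lemma cornerArea_comp (g : Plane →ₗ[ℝ] Plane) (v : Fin m → Plane) (i : Fin m) :
    cornerArea (g ∘ v) i = LinearMap.det g * cornerArea v i :=
  triArea_map g _ _ _

namespace IsConvexCycle

lemma comp (h : IsConvexCycle v) (g : Plane ≃ₗ[ℝ] Plane) : IsConvexCycle (g ∘ v) where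
  three_le := h.three_le
  pos i j hj hj' := by
    have hpos := mul_pos (mul_self_pos.mpr (LinearEquiv.isUnit_det' g).ne_zero) (h.pos i j hj hj')
    rw [mul_mul_mul_comm, ← edgeArea_comp, ← triArea_map] at hpos
    exact hpos

lemma areaFunctional_comp (h : IsConvexCycle v) (g : Plane ≃ₗ[ℝ] Plane) :
    areaFunctional (g ∘ v) = areaFunctional v := by
  have hdet := (LinearEquiv.isUnit_det' g).ne_zero
  refine Finset.sum_congr rfl fun i _ => ?_
  rw [← g.coe_coe, edgeArea_comp, cornerArea_comp, Real.log_mul hdet (h.cornerArea_ne i),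
    Real.log_mul hdet (h.edgeArea_ne i), add_sub_add_left_eq_sub]

end IsConvexCycle

/-- The point of the unit circle with polar angle `t`. -/
noncomputable def circlePoint (t : ℝ) : Plane := !₂[Real.cos t, Real.sin t]

lemma cross_circlePoint (s t : ℝ) : cross (circlePoint s) (circlePoint t) = Real.sin (t - s) := by
  rw [cross_eq_coord, Real.sin_sub]
  simp only [circlePoint, PiLp.toLp_apply, Matrix.cons_val_zero, Matrix.cons_val_one]
  ring

lemma circlePoint_add_nat_mul_two_pi (t : ℝ) (n : ℕ) :
    circlePoint (t + n * (2 * Real.pi)) = circlePoint t := by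
  rw [circlePoint, circlePoint, Real.cos_add_nat_mul_two_pi, Real.sin_add_nat_mul_two_pi]

lemma circlePoint_add_add_circlePoint_sub (t θ : ℝ) :
    circlePoint (t + θ) + circlePoint (t - θ) = (2 * Real.cos θ) • circlePoint t := by
  ext k
  fin_cases k <;>
    simp only [circlePoint, Real.cos_add, Real.cos_sub, Real.sin_add, Real.sin_sub, Fin.zero_eta,
      Fin.mk_one, PiLp.add_apply, PiLp.smul_apply, Matrix.cons_val_zero,
      Matrix.cons_val_one, Matrix.cons_val_fin_one, smul_eq_mul] <;>
    ring

lemma triArea_circlePoint (s a b : ℝ) :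
    triArea (circlePoint s) (circlePoint (s + 2 * a)) (circlePoint (s + 2 * b)) =
      4 * Real.sin a * (Real.sin b * Real.sin (b - a)) := by
  rw [triArea, cross_circlePoint, cross_circlePoint, cross_circlePoint, add_sub_cancel_left,
    add_sub_add_left_eq_sub, sub_add_cancel_left, Real.sin_neg, Real.sin_sub, Real.sin_sub,
    Real.sin_two_mul, Real.sin_two_mul, Real.cos_two_mul, Real.cos_two_mul]
  linear_combination 4 * (Real.sin b * Real.cos b) * Real.sin_sq_add_cos_sq a -
    4 * (Real.sin a * Real.cos a) * Real.sin_sq_add_cos_sq b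

/-- The vertices of the regular `m`-gon. -/
noncomputable def regularCycle (m : ℕ) (k : Fin m) : Plane := circlePoint (2 * Real.pi * k / m)

lemma regularCycle_add_ofNat (i : Fin m) (n : ℕ) :
    regularCycle m (i + Fin.ofNat m n) =
      circlePoint (2 * Real.pi * i / m + 2 * (n * (Real.pi / m))) := by
  have hm : (m : ℝ) ≠ 0 := NeZero.ne _
  have hval : ((i + Fin.ofNat m n).val : ℝ) + m * ((i.val + n) / m : ℕ) = i.val + n := by
    rw [Fin.val_add, Fin.val_ofNat, Nat.add_mod_mod]
    exact_mod_cast Nat.mod_add_div (i.val + n) m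
  rw [regularCycle, ← circlePoint_add_nat_mul_two_pi _ ((i.val + n) / m)]
  congr 1
  field_simp
  linear_combination hval

lemma regularCycle_succ (i : Fin m) :
    regularCycle m (i + 1) = circlePoint (2 * Real.pi * i / m + 2 * (Real.pi / m)) := by
  rw [← ofNat_one, regularCycle_add_ofNat, Nat.cast_one, one_mul]

lemma edgeArea_regularCycle (i : Fin m) :
    edgeArea (regularCycle m) i = Real.sin (2 * (Real.pi / m)) := by
  rw [edgeArea, regularCycle_succ, regularCycle, cross_circlePoint, add_sub_cancel_left]

lemma isConvexCycle_regularCycle (hm : 3 ≤ m) : IsConvexCycle (regularCycle m) where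
  three_le := hm
  pos i j hj hj' := by
    have hm' : (3 : ℝ) ≤ m := mod_cast hm
    have hα : 0 < Real.pi / m := by positivity
    have hmα : m * (Real.pi / m) = Real.pi := by field_simp
    have hsin : ∀ x : ℝ, 0 < x → x < m → 0 < Real.sin (x * (Real.pi / m)) := fun x h0 hlt =>
      Real.sin_pos_of_pos_of_lt_pi (mul_pos h0 hα) ((mul_lt_mul_of_pos_right hlt hα).trans_eq hmα)
    obtain ⟨n, rfl⟩ : ∃ n : Fin m, j = i + n := ⟨j - i, (add_sub_cancel i j).symm⟩
    have h2n : 2 ≤ n.val := by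
      refine (Nat.two_le_iff _).mpr ⟨fun h0 => hj ?_, fun h1 => hj' ?_⟩
      · rw [show n = 0 from Fin.ext h0, add_zero]
      · rw [← Fin.ofNat_val_eq_self n, h1, ofNat_one]
    have h2n' : (2 : ℝ) ≤ n.val := mod_cast h2n
    have hnm : (n.val : ℝ) < m := mod_cast n.isLt
    rw [edgeArea_regularCycle, ← Fin.ofNat_val_eq_self n, regularCycle_add_ofNat,
      regularCycle_succ, regularCycle, triArea_circlePoint, ← sub_one_mul]
    have h1 := hsin 1 one_pos (by linarith)
    rw [one_mul] at h1
    exact mul_pos (hsin 2 two_pos (by linarith)) (mul_pos (mul_pos four_pos h1)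
      (mul_pos (hsin n (by linarith) hnm) (hsin (n - 1) (by linarith) (by linarith))))

lemma sum_norm_add_succ_sq {t : ℝ} (hv : ∀ i, v (i + 1) + v (i - 1) = t • v i) :
    ∑ i, ‖v i + v (i + 1)‖ ^ 2 = (2 + t) * ∑ i, ‖v i‖ ^ 2 := by
  have hprev : ∑ i, inner ℝ (v i) (v (i - 1)) = ∑ i, inner ℝ (v i) (v (i + 1)) := by
    rw [← sum_succ]
    simp only [add_sub_cancel_right, real_inner_comm]
  have hinner : t * ∑ i, ‖v i‖ ^ 2 = 2 * ∑ i, inner ℝ (v i) (v (i + 1)) := by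
    rw [two_mul]
    nth_rw 1 [← hprev]
    rw [← Finset.sum_add_distrib, Finset.mul_sum]
    refine Finset.sum_congr rfl fun i _ => ?_
    rw [← inner_add_right, add_comm, hv, inner_smul_right, real_inner_self_eq_norm_sq]
  simp only [norm_add_sq_real, Finset.sum_add_distrib, ← Finset.mul_sum,
    sum_succ fun i => ‖v i‖ ^ 2]
  linarith

lemma exists_eq_comp_circlePoint {θ : ℝ} (hθ : Real.sin θ ≠ 0) (h0 : edgeArea v 0 ≠ 0)
    (hv : ∀ i, v (i + 1) + v (i - 1) = (2 * Real.cos θ) • v i) :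
    ∃ g : Plane ≃ₗ[ℝ] Plane, ∀ n : ℕ, v (Fin.ofNat m n) = g (circlePoint (n * θ)) := by
  obtain ⟨g, hg0, hg1⟩ := exists_linearEquiv (a := circlePoint 0) (b := circlePoint θ)
    (by rwa [cross_circlePoint, sub_zero]) h0
  refine ⟨g, fun n => ?_⟩
  induction n using Nat.twoStepInduction with
  | zero => rw [Nat.cast_zero, zero_mul, hg0, Fin.ofNat_zero]
  | one => rw [Nat.cast_one, one_mul, hg1, ofNat_one, zero_add]
  | more n ih ih' =>
    have hn := hv (Fin.ofNat m (n + 1))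
    rw [← ofNat_succ, ofNat_succ n, add_sub_cancel_right, ← ofNat_succ n, ih, ih'] at hn
    rw [eq_sub_of_add_eq hn, ← map_smul, ← circlePoint_add_add_circlePoint_sub, ← map_sub]
    push_cast
    ring_nf
    rw [add_sub_cancel_right]

lemma nat_mul_lt_pi_of_sin_mul_sin_pos {x : ℝ} (hx : 0 < x) (hx' : x < Real.pi) {N : ℕ}
    (h : ∀ n : ℕ, 1 ≤ n → n < N → 0 < Real.sin (n * x) * Real.sin ((n + 1) * x)) :
    N * x < Real.pi := by
  induction N with
  | zero => simpa using Real.pi_pos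
  | succ N ih =>
    have hN := ih fun n h1 hn => h n h1 (hn.trans N.lt_succ_self)
    rcases Nat.eq_zero_or_pos N with rfl | hN0
    · simpa using hx'
    · have hsin := Real.sin_pos_of_pos_of_lt_pi (by positivity) hN
      have hsin' := pos_of_mul_pos_right (h N hN0 N.lt_succ_self) hsin.le
      push_cast
      by_contra! hge
      have hnonneg := Real.sin_nonneg_of_nonneg_of_le_pi (sub_nonneg.mpr hge) (by linarith)
      rw [Real.sin_sub_pi] at hnonneg
      linarith

namespace IsConvexCycle

lemma exists_angle (h : IsConvexCycle v) (hv : IsEquiareal v) :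
    ∃ θ, 0 < θ ∧ θ < Real.pi ∧ ∀ i, v (i + 1) + v (i - 1) = (2 * Real.cos θ) • v i := by
  obtain ⟨⟨D, hD⟩, E, hE⟩ := hv
  have hrec : ∀ i, v (i + 1) + v (i - 1) = (2 - D * E) • v i := fun i => by
    rw [apply_succ_eq_sub_smul (h.edgeArea_ne i), apply_pred_eq_add_smul (h.edgeArea_ne _),
      polarCycle_eq_add_smul (h.edgeArea_ne i) (h.edgeArea_ne _), hD, hD, hE]
    module
  have hpos : 0 < D * E := by
    simpa only [hD, hE] using h.edgeArea_mul_polarArea_pos 0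
  have hlt : D * E < 4 := by
    have hsum : 0 < ∑ i, ‖v i + v (i + 1)‖ ^ 2 := by
      refine Finset.sum_pos (fun i _ => sq_pos_of_ne_zero (norm_ne_zero_iff.mpr fun h0 => ?_))
        Finset.univ_nonempty
      refine h.edgeArea_ne i ?_
      rw [edgeArea, eq_neg_of_add_eq_zero_right h0, map_neg, cross_self, neg_zero]
    rw [sum_norm_add_succ_sq hrec] at hsum
    linarith [pos_of_mul_pos_left hsum (Finset.sum_nonneg fun i _ => sq_nonneg _)]
  have hcos : Real.cos (Real.arccos (1 - D * E / 2)) = 1 - D * E / 2 :=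
    Real.cos_arccos (by linarith) (by linarith)
  refine ⟨Real.arccos (1 - D * E / 2), Real.arccos_pos.mpr (by linarith),
    (Real.arccos_le_pi _).lt_of_ne fun hπ => ?_, fun i => ?_⟩
  · rw [hπ, Real.cos_pi] at hcos
    linarith
  · rw [hrec, hcos]
    congr 1
    ring

lemma pred_mul_angle_lt (h : IsConvexCycle v) {θ : ℝ} (hθ : 0 < θ) (hθ' : θ < Real.pi)
    {g : Plane →ₗ[ℝ] Plane} (hg : ∀ n : ℕ, v (Fin.ofNat m n) = g (circlePoint (n * θ))) :
    (m - 1 : ℕ) * (θ / 2) < Real.pi := by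
  refine nat_mul_lt_pi_of_sin_mul_sin_pos (half_pos hθ) (by linarith) fun n h1 hn => ?_
  have hval : (Fin.ofNat m (n + 1)).val = n + 1 := Nat.mod_eq_of_lt (by lia)
  have hne : Fin.ofNat m (n + 1) ≠ 0 := fun h0 => by
    rw [h0, Fin.val_zero] at hval
    lia
  have hne' : Fin.ofNat m (n + 1) ≠ 0 + 1 := fun h0 => by
    rw [h0, zero_add, Fin.val_one', Nat.mod_eq_of_lt (by lia)] at hval
    lia
  have hpos := h.pos 0 _ hne hne'
  have h0 : v 0 = g (circlePoint 0) := by simpa using hg 0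
  have h1 : v (0 + 1) = g (circlePoint (0 + 2 * (θ / 2))) := by
    rw [zero_add, ← ofNat_one, hg, Nat.cast_one, one_mul, zero_add, mul_div_cancel₀ _ two_ne_zero]
  have hn : v (Fin.ofNat m (n + 1)) = g (circlePoint (0 + 2 * ((n + 1) * (θ / 2)))) := by
    rw [hg]
    push_cast
    ring_nf
  rw [edgeArea, hn, h0, h1, cross_map, triArea_map, triArea_circlePoint, cross_circlePoint,
    mul_mul_mul_comm, add_sub_cancel_left, mul_div_cancel₀ _ two_ne_zero,
    ← sub_one_mul, add_sub_cancel_right] at hpos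
  have hsin := Real.sin_pos_of_pos_of_lt_pi hθ hθ'
  have hsin' := Real.sin_pos_of_pos_of_lt_pi (half_pos hθ) (by linarith)
  rw [mul_comm]
  exact pos_of_mul_pos_right (pos_of_mul_pos_right (pos_of_mul_pos_right hpos
    (mul_self_nonneg _)) hsin.le) (mul_pos four_pos hsin').le

lemma exists_eq_comp_regularCycle (h : IsConvexCycle v) (hv : IsEquiareal v) :
    ∃ g : Plane ≃ₗ[ℝ] Plane, v = g ∘ regularCycle m := by
  obtain ⟨θ, hθ, hθ', hrec⟩ := h.exists_angle hv
  obtain ⟨g, hg⟩ := exists_eq_comp_circlePoint (Real.sin_pos_of_pos_of_lt_pi hθ hθ').ne'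
    (h.edgeArea_ne 0) hrec
  have hlt := h.pred_mul_angle_lt hθ hθ' hg
  have hclose : circlePoint (m * θ) = circlePoint 0 := g.injective <| by
    rw [← hg, Fin.ofNat_self, ← Fin.ofNat_zero, hg, Nat.cast_zero, zero_mul]
  have hcos : Real.cos (m * θ) = 1 := by
    simpa [circlePoint] using congrArg (· 0) hclose
  obtain ⟨k, hk⟩ := (Real.cos_eq_one_iff _).mp hcos
  have hm : (3 : ℝ) ≤ m := mod_cast h.three_le
  have hk1 : k = 1 := by
    rw [Nat.cast_pred (Nat.pos_of_neZero m)] at hlt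
    have hpos : (0 : ℝ) < k := by nlinarith [Real.pi_pos]
    have hlt2 : (k : ℝ) < 2 := by nlinarith [Real.pi_pos]
    norm_cast at hpos hlt2
    lia
  refine ⟨g, funext fun i => ?_⟩
  rw [← Fin.ofNat_val_eq_self i, hg, Function.comp_apply, Fin.ofNat_val_eq_self, regularCycle]
  congr 2
  rw [hk1, Int.cast_one, one_mul] at hk
  field_simp
  linear_combination -i.val * hk

end IsConvexCycle

/-! ### Existence of a maximum -/

lemma exists_linearEquiv_norm_le (hi : edgeArea v i ≠ 0) :
    ∃ g : Plane ≃ₗ[ℝ] Plane, (∀ j, ‖g (v j)‖ ≤ 2) ∧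
      ∀ f C, (∀ j, |cross f (g (v j))| ≤ C) → ‖f‖ ≤ 2 * C := by
  obtain ⟨⟨a, b⟩, hab⟩ := Finite.exists_max fun p : Fin m × Fin m => |cross (v p.1) (v p.2)|
  have hne : cross (v a) (v b) ≠ 0 := abs_pos.mp ((abs_pos.mpr hi).trans_le (hab (i, i + 1)))
  have hbasis : cross (EuclideanSpace.single 0 1) (EuclideanSpace.single 1 1) = 1 := by
    simp [cross_eq_coord]
  obtain ⟨g, hga, hgb⟩ := exists_linearEquiv hne (hbasis.trans_ne one_ne_zero)
  rw [← hga, ← hgb] at hbasis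
  have hnorma : ‖g (v a)‖ = 1 := by rw [hga, PiLp.norm_single, norm_one]
  have hnormb : ‖g (v b)‖ = 1 := by rw [hgb, PiLp.norm_single, norm_one]
  have hnorm : ∀ x, ‖x‖ ≤ |cross x (g (v b))| + |cross x (g (v a))| := fun x => by
    have h := norm_sub_le (cross x (g (v b)) • g (v a)) (cross x (g (v a)) • g (v b))
    rwa [← cross_smul_eq, hbasis, one_smul, norm_smul, norm_smul, hnorma, hnormb,
      mul_one, mul_one] at h
  have hle : ∀ j k, |cross (g (v j)) (g (v k))| ≤ 1 := fun j k => by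
    rw [← abs_one, ← hbasis, ← g.coe_coe, cross_map, cross_map, abs_mul, abs_mul]
    exact mul_le_mul_of_nonneg_left (hab (j, k)) (abs_nonneg _)
  refine ⟨g, fun j => ?_, fun f C hC => ?_⟩
  · linarith [hnorm (g (v j)), hle j a, hle j b]
  · linarith [hnorm f, hC a, hC b]

lemma exp_sub_le_of_le_sum_log {ι : Type*} [Fintype ι] {x : ι → ℝ} {c C : ℝ} (hC : 1 ≤ C)
    (hx : ∀ i, 0 < x i) (hxC : ∀ i, x i ≤ C) (hc : c ≤ ∑ i, Real.log (x i)) (i : ι) :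
    Real.exp (c - Fintype.card ι * Real.log C) ≤ x i := by
  classical
  have hrest : ∑ j ∈ Finset.univ.erase i, Real.log (x j) ≤ Fintype.card ι * Real.log C := by
    calc ∑ j ∈ Finset.univ.erase i, Real.log (x j)
        ≤ ∑ _j ∈ Finset.univ.erase i, Real.log C :=
          Finset.sum_le_sum fun j _ => Real.log_le_log (hx j) (hxC j)
      _ ≤ ∑ _j : ι, Real.log C := Finset.sum_le_sum_of_subset_of_nonneg
          (Finset.erase_subset _ _) fun _ _ _ => Real.log_nonneg hC
      _ = Fintype.card ι * Real.log C := by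
          rw [Finset.sum_const, Finset.card_univ, nsmul_eq_mul]
  rw [← Real.le_log_iff_exp_le (hx i)]
  rw [← Finset.add_sum_erase _ _ (Finset.mem_univ i)] at hc
  linarith

/-- A compact set of convex cycles: the vertices are bounded, and the inequalities that express
convexity hold with the margin `δ`. -/
def uniformlyConvexCycles (m : ℕ) [NeZero m] (δ : ℝ) : Set (Fin m → Plane) :=
  {v | (∀ i, ‖v i‖ ≤ 2) ∧ ∑ i, v i = 0 ∧
    ∀ i j, j ≠ i → j ≠ i + 1 → δ ≤ edgeArea v i * triArea (v i) (v (i + 1)) (v j)}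

lemma isConvexCycle_of_mem_uniformlyConvexCycles (hm : 3 ≤ m) {δ : ℝ} (hδ : 0 < δ)
    (hv : v ∈ uniformlyConvexCycles m δ) : IsConvexCycle v :=
  ⟨hm, fun i j hj hj' => hδ.trans_le (hv.2.2 i j hj hj')⟩

lemma isCompact_uniformlyConvexCycles (m : ℕ) [NeZero m] (δ : ℝ) :
    IsCompact (uniformlyConvexCycles m δ) := by
  refine Metric.isCompact_of_isClosed_isBounded ?_
    (Metric.isBounded_closedBall.subset fun v hv => mem_closedBall_zero_iff.mpr
      ((pi_norm_le_iff_of_nonneg zero_le_two).mpr hv.1))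
  simp only [uniformlyConvexCycles, ofPred_and, ofPred_forall, edgeArea, triArea]
  refine .inter (isClosed_iInter fun i => isClosed_le (by fun_prop) continuous_const) <|
    .inter (isClosed_eq (by fun_prop) continuous_const) <| isClosed_iInter fun i =>
    isClosed_iInter fun j => isClosed_iInter fun _ => isClosed_iInter fun _ =>
    isClosed_le continuous_const (by fun_prop)

namespace IsConvexCycle

lemma continuousAt_areaFunctional (h : IsConvexCycle v) : ContinuousAt areaFunctional v := by
  refine tendsto_finsetSum _ fun i _ => .sub (ContinuousAt.log ?_ (h.cornerArea_ne i))
    (ContinuousAt.log ?_ (h.edgeArea_ne i))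
  · unfold cornerArea triArea
    fun_prop
  · unfold edgeArea
    fun_prop

lemma cross_le_of_le_neighbors (h : IsConvexCycle v) {f : Plane} {k : Fin m}
    (hpred : cross f (v (k - 1)) ≤ cross f (v k)) (hsucc : cross f (v (k + 1)) ≤ cross f (v k))
    (j : Fin m) : cross f (v j) ≤ cross f (v k) := by
  have hE := mul_self_pos.mpr (h.polarArea_ne k)
  rw [apply_pred_eq_add_smul (h.edgeArea_ne _), map_add, map_smul, smul_eq_mul] at hpred
  rw [apply_succ_eq_sub_smul (h.edgeArea_ne k), map_sub, map_smul, smul_eq_mul] at hsucc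
  have ha : 0 ≤ polarArea v k * cross f (polarCycle v k) := by
    have hpos := h.edgeArea_mul_polarArea_pos k
    nlinarith [mul_self_pos.mpr (h.edgeArea_ne k)]
  have hb : polarArea v k * cross f (polarCycle v (k - 1)) ≤ 0 := by
    have hpos := h.edgeArea_pred_mul_polarArea_pos k
    nlinarith [mul_self_pos.mpr (h.edgeArea_ne (k - 1))]
  have heval : ∀ x, polarArea v k * cross f x = cross f (polarCycle v k) *
      cross (polarCycle v (k - 1)) x - cross f (polarCycle v (k - 1)) * cross (polarCycle v k) x :=
    fun x => by
      have hx := congrArg (cross · x) (cross_smul_eq (polarCycle v (k - 1)) (polarCycle v k) f)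
      simpa only [polarArea, map_smul, map_sub, smul_apply, sub_apply, smul_eq_mul] using hx
  have hk := heval (v k)
  rw [cross_polarCycle_self (h.edgeArea_ne k), cross_polarCycle_pred (h.edgeArea_ne _)] at hk
  have hnonneg : 0 ≤ polarArea v k * polarArea v k * (cross f (v k) - cross f (v j)) := by
    rw [mul_assoc, mul_sub, hk, heval (v j)]
    nlinarith [mul_nonneg ha (sub_nonneg.mpr (h.cross_le (k - 1) j)),
      mul_nonneg (neg_nonneg.mpr hb) (sub_nonneg.mpr (h.cross_le k j))]
  exact sub_nonneg.mp (nonneg_of_mul_nonneg_right hnonneg hE)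

lemma le_one_sub_cross (h : IsConvexCycle v) {η : ℝ}
    (hpred : ∀ i, η ≤ 1 - cross (polarCycle v i) (v (i - 1)))
    (hsucc : ∀ i, η ≤ 1 - cross (polarCycle v (i - 1)) (v (i + 1))) {i j : Fin m} (hj : j ≠ i)
    (hj' : j ≠ i + 1) : η ≤ 1 - cross (polarCycle v i) (v j) := by
  obtain ⟨k, hk, hmax⟩ := {k : Fin m | k ≠ i ∧ k ≠ i + 1}.exists_max_image
    (fun k => cross (polarCycle v i) (v k)) (toFinite _) ⟨j, hj, hj'⟩
  refine le_trans ?_ (sub_le_sub_left (hmax j ⟨hj, hj'⟩) 1)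
  by_cases hkpred : k = i - 1
  · rw [hkpred]
    exact hpred i
  by_cases hksucc : k = i + 1 + 1
  · simpa only [hksucc, add_sub_cancel_right] using hsucc (i + 1)
  -- otherwise `v k` would be a local maximum of `cross (polarCycle v i)` on the polygon
  have hle := h.cross_le_of_le_neighbors
    (hmax (k - 1) ⟨fun e => hk.2 (eq_add_of_sub_eq e), fun e => hksucc (eq_add_of_sub_eq e)⟩)
    (hmax (k + 1) ⟨fun e => hkpred (eq_sub_of_add_eq e), fun e => hk.1 (add_right_cancel e)⟩) i
  rw [cross_polarCycle_self (h.edgeArea_ne i)] at hle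
  exact absurd hle (h.cross_lt hk.1 hk.2).not_ge

lemma one_sub_cross_le (h : IsConvexCycle v) (hv : ∑ i, v i = 0) (i j : Fin m) :
    1 - cross (polarCycle v i) (v j) ≤ m := by
  have hsum : ∑ j, (1 - cross (polarCycle v i) (v j)) = m := by
    rw [Finset.sum_sub_distrib, ← map_sum, hv, map_zero, sub_zero, Finset.sum_const,
      Finset.card_univ, Fintype.card_fin, nsmul_eq_mul, mul_one]
  rw [← hsum]
  exact Finset.single_le_sum (fun k _ => sub_nonneg.mpr (h.cross_le i k)) (Finset.mem_univ j)

lemma exp_le_one_sub_cross (h : IsConvexCycle v) (hv : ∑ i, v i = 0) {i j : Fin m} (hj : j ≠ i)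
    (hj' : j ≠ i + 1) :
    Real.exp (areaFunctional v - m * Real.log m) ≤ 1 - cross (polarCycle v i) (v j) := by
  have hm : (1 : ℝ) ≤ m := mod_cast NeZero.one_le
  have hpred : ∀ i, 1 - cross (polarCycle v i) (v (i - 1)) = edgeArea v (i - 1) * polarArea v i :=
    fun i => one_sub_cross_polarCycle_pred (h.edgeArea_ne _) (h.edgeArea_ne _)
  have hsucc : ∀ i, 1 - cross (polarCycle v (i - 1)) (v (i + 1)) = edgeArea v i * polarArea v i :=
    fun i => one_sub_cross_polarCycle_succ (h.edgeArea_ne _) (h.edgeArea_ne _)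
  have hlog : ∀ i j, Real.log (edgeArea v i * polarArea v j) =
      Real.log (edgeArea v i) + Real.log (polarArea v j) := fun i j =>
    Real.log_mul (h.edgeArea_ne i) (h.polarArea_ne j)
  have hexp : ∀ x : Fin m → ℝ, (∀ i, 0 < x i) → (∀ i, x i ≤ m) →
      areaFunctional v = ∑ i, Real.log (x i) →
      ∀ i, Real.exp (areaFunctional v - m * Real.log m) ≤ x i := fun x hx hxm hsum => by
    simpa only [Fintype.card_fin] using exp_sub_le_of_le_sum_log hm hx hxm hsum.le
  refine h.le_one_sub_cross
    (hexp _ (fun i => ?_) (fun i => h.one_sub_cross_le hv _ _) ?_)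
    (hexp _ (fun i => ?_) (fun i => h.one_sub_cross_le hv _ _) ?_) hj hj'
  · rw [hpred]
    exact h.edgeArea_pred_mul_polarArea_pos i
  · simp only [hpred, hlog, Finset.sum_add_distrib, sum_pred fun i => Real.log (edgeArea v i),
      h.areaFunctional_eq]
  · rw [hsucc]
    exact h.edgeArea_mul_polarArea_pos i
  · simp only [hsucc, hlog, Finset.sum_add_distrib, h.areaFunctional_eq]

lemma abs_polarArea_le (h : IsConvexCycle v) (hv : ∑ i, v i = 0)
    (hnorm : ∀ f C, (∀ j, |cross f (v j)| ≤ C) → ‖f‖ ≤ 2 * C) (i : Fin m) :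
    |polarArea v i| ≤ (2 * m) * (2 * m) := by
  have hpolar : ∀ i, ‖polarCycle v i‖ ≤ 2 * m := fun i => hnorm _ _ fun j => by
    have hm : (1 : ℝ) ≤ m := mod_cast NeZero.one_le
    exact abs_le.mpr ⟨by linarith [h.one_sub_cross_le hv i j], (h.cross_le i j).trans hm⟩
  exact (abs_cross_le _ _).trans (mul_le_mul (hpolar _) (hpolar _) (norm_nonneg _) (by positivity))

lemma exp_pow_three_div_le (h : IsConvexCycle v) (hv : ∑ i, v i = 0)
    (hnorm : ∀ f C, (∀ j, |cross f (v j)| ≤ C) → ‖f‖ ≤ 2 * C) {i j : Fin m} (hj : j ≠ i)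
    (hj' : j ≠ i + 1) :
    Real.exp (areaFunctional v - m * Real.log m) ^ 3 / ((2 * m) * (2 * m)) ^ 2 ≤
      edgeArea v i * triArea (v i) (v (i + 1)) (v j) := by
  have hm : 0 < (m : ℝ) := mod_cast Nat.pos_of_neZero m
  set η := Real.exp (areaFunctional v - m * Real.log m)
  have hgap : ∀ {i j : Fin m}, j ≠ i → j ≠ i + 1 → η ≤ 1 - cross (polarCycle v i) (v j) :=
    h.exp_le_one_sub_cross hv
  have hedge : η ≤ |edgeArea v i| * ((2 * m) * (2 * m)) :=
    calc η ≤ 1 - cross (polarCycle v (i - 1)) (v (i + 1)) :=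
          hgap (pred_ne_succ h.three_le i).symm (by rw [sub_add_cancel]; exact succ_ne h.three_le i)
      _ = edgeArea v i * polarArea v i :=
          one_sub_cross_polarCycle_succ (h.edgeArea_ne _) (h.edgeArea_ne _)
      _ ≤ |edgeArea v i| * |polarArea v i| := (le_abs_self _).trans_eq (abs_mul _ _)
      _ ≤ |edgeArea v i| * ((2 * m) * (2 * m)) :=
          mul_le_mul_of_nonneg_left (h.abs_polarArea_le hv hnorm i) (abs_nonneg _)
  rw [div_le_iff₀ (by positivity)]
  calc η ^ 3 = η ^ 2 * η := pow_succ η 2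
    _ ≤ (|edgeArea v i| * ((2 * m) * (2 * m))) ^ 2 * (1 - cross (polarCycle v i) (v j)) := by
        gcongr
        exact hgap hj hj'
    _ = edgeArea v i * triArea (v i) (v (i + 1)) (v j) * ((2 * m) * (2 * m)) ^ 2 := by
        rw [← edgeArea_mul_one_sub_cross (h.edgeArea_ne i), mul_pow, sq_abs]
        ring

lemma exists_comp_mem_uniformlyConvexCycles (h : IsConvexCycle v) (hv : ∑ i, v i = 0) {c : ℝ}
    (hc : c ≤ areaFunctional v) :
    ∃ g : Plane ≃ₗ[ℝ] Plane, g ∘ v ∈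
      uniformlyConvexCycles m (Real.exp (c - m * Real.log m) ^ 3 / ((2 * m) * (2 * m)) ^ 2) := by
  obtain ⟨g, hnorm, hcross⟩ := exists_linearEquiv_norm_le (h.edgeArea_ne 0)
  have hg := h.comp g
  have hsum : ∑ i, (g ∘ v) i = 0 := by
    simp only [Function.comp_apply, ← map_sum, hv, map_zero]
  refine ⟨g, hnorm, hsum, fun i j hj hj' =>
    le_trans ?_ (hg.exp_pow_three_div_le hsum hcross hj hj')⟩
  rw [h.areaFunctional_comp g]
  gcongr

lemma exists_forall_areaFunctional_le (h : IsConvexCycle v) (hv : ∑ i, v i = 0) :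
    ∃ w : Fin m → Plane, IsConvexCycle w ∧ ∑ i, w i = 0 ∧
      ∀ u : Fin m → Plane, IsConvexCycle u → ∑ i, u i = 0 →
        areaFunctional u ≤ areaFunctional w := by
  set δ := Real.exp (areaFunctional v - m * Real.log m) ^ 3 / ((2 * m) * (2 * m)) ^ 2
  have hm : 0 < (m : ℝ) := mod_cast Nat.pos_of_neZero m
  have hconvex : ∀ u ∈ uniformlyConvexCycles m δ, IsConvexCycle u := fun u hu =>
    isConvexCycle_of_mem_uniformlyConvexCycles h.three_le (by positivity) hu
  obtain ⟨g, hg⟩ := h.exists_comp_mem_uniformlyConvexCycles hv le_rfl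
  obtain ⟨w, hw, hmax⟩ := (isCompact_uniformlyConvexCycles m δ).exists_isMaxOn ⟨_, hg⟩
    fun u hu => (hconvex u hu).continuousAt_areaFunctional.continuousWithinAt
  refine ⟨w, hconvex w hw, hw.2.1, fun u hu hu0 => ?_⟩
  rcases le_total (areaFunctional v) (areaFunctional u) with hle | hle
  · obtain ⟨g', hg'⟩ := hu.exists_comp_mem_uniformlyConvexCycles hu0 hle
    exact (hu.areaFunctional_comp g').symm.trans_le (hmax hg')
  · exact hle.trans ((h.areaFunctional_comp g).symm.trans_le (hmax hg))

lemma areaFunctional_le_regularCycle (h : IsConvexCycle v) (hv : ∑ i, v i = 0) :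
    areaFunctional v ≤ areaFunctional (regularCycle m) := by
  obtain ⟨w, hw, hw0, hmax⟩ := h.exists_forall_areaFunctional_le hv
  obtain ⟨g, rfl⟩ := hw.exists_eq_comp_regularCycle
    (hw.isEquiareal_of_forall_areaFunctional_le hw0 hmax)
  rw [← (isConvexCycle_regularCycle h.three_le).areaFunctional_comp g]
  exact hmax v h hv

lemma isEquiareal_of_regularCycle_le (h : IsConvexCycle v) (hv : ∑ i, v i = 0)
    (hle : areaFunctional (regularCycle m) ≤ areaFunctional v) : IsEquiareal v :=
  h.isEquiareal_of_forall_areaFunctional_le hv fun _ hw hw0 =>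
    (hw.areaFunctional_le_regularCycle hw0).trans hle

end IsConvexCycle

/-! ### The centre of minimal value -/

lemma edgeArea_sub (hi : edgeArea v i ≠ 0) (x : Plane) :
    edgeArea (fun j => v j - x) i = edgeArea v i * (1 - cross (polarCycle v i) x) := by
  rw [edgeArea_mul_one_sub_cross hi, ← triArea_sub _ _ _ x, sub_self, triArea, map_zero, map_zero,
    zero_apply, add_zero, add_zero, edgeArea]

lemma cornerArea_sub (v : Fin m → Plane) (i : Fin m) (x : Plane) :
    cornerArea (fun j => v j - x) i = cornerArea v i :=
  triArea_sub _ _ _ x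

lemma image_sub_convexHull_range {ι E : Type*} [AddCommGroup E] [Module ℝ E] (v : ι → E) (x : E) :
    (fun p => p - x) '' convexHull ℝ (range v) = convexHull ℝ (range fun i => v i - x) := by
  rw [← sub_singleton, ← convexHull_singleton (𝕜 := ℝ) x, ← convexHull_sub, sub_singleton,
    ← range_comp]
  rfl

lemma hasDerivAt_sum_log_one_sub {ι : Type*} [Fintype ι] (c : ι → ℝ) :
    HasDerivAt (fun t : ℝ => ∑ i, Real.log (1 - t * c i)) (-∑ i, c i) 0 := by
  rw [← Finset.sum_neg_distrib]
  refine HasDerivAt.fun_sum fun i _ => ?_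
  simpa using (((hasDerivAt_id (0 : ℝ)).mul_const (c i)).const_sub 1).log (by simp)

lemma sum_log_one_sub_neg {ι : Type*} [Fintype ι] {c : ι → ℝ} (hc : ∀ i, c i < 1)
    (hsum : ∑ i, c i = 0) (hne : c ≠ 0) : ∑ i, Real.log (1 - c i) < 0 := by
  obtain ⟨i, hi⟩ := Function.ne_iff.mp hne
  calc ∑ i, Real.log (1 - c i) < ∑ i, (1 - c i - 1) :=
        Finset.sum_lt_sum (fun j _ => Real.log_le_sub_one_of_pos (sub_pos.mpr (hc j)))
          ⟨i, Finset.mem_univ i,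
            Real.log_lt_sub_one_of_pos (sub_pos.mpr (hc i)) (sub_eq_self.not.mpr hi)⟩
    _ = 0 := by
        simp only [sub_sub_cancel_left, Finset.sum_neg_distrib, hsum, neg_zero]

lemma sum_polarCycle_eq_zero {D : ℝ} (hD : ∀ i, edgeArea v i = D) : ∑ i, polarCycle v i = 0 := by
  simp only [polarCycle, hD, ← Finset.smul_sum, Finset.sum_sub_distrib, sum_succ v, sub_self,
    smul_zero]

namespace IsConvexCycle

lemma translate (h : IsConvexCycle v) {x : Plane} (hx : ∀ i, cross (polarCycle v i) x < 1) :
    IsConvexCycle fun i => v i - x where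
  three_le := h.three_le
  pos i j hj hj' := by
    rw [edgeArea_sub (h.edgeArea_ne i), triArea_sub, mul_right_comm]
    exact mul_pos (h.pos i j hj hj') (sub_pos.mpr (hx i))

lemma secondTermAt_convexHull (h : IsConvexCycle v) {x : Plane}
    (hx : ∀ i, cross (polarCycle v i) x < 1) :
    secondTermAt (convexHull ℝ (range v)) x =
      areaFunctional v - ∑ i, Real.log (1 - cross (polarCycle v i) x) := by
  rw [secondTermAt, image_sub_convexHull_range, (h.translate hx).secondTerm_convexHull,
    areaFunctional, areaFunctional, ← Finset.sum_sub_distrib]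
  refine Finset.sum_congr rfl fun i _ => ?_
  rw [cornerArea_sub, edgeArea_sub (h.edgeArea_ne i),
    Real.log_mul (h.edgeArea_ne i) (sub_pos.mpr (hx i)).ne', sub_sub]

lemma isSantaloPointAtInfinity_zero_iff_forall (h : IsConvexCycle v) :
    IsSantaloPointAtInfinity (convexHull ℝ (range v)) 0 ↔
      ∀ x, (∀ i, cross (polarCycle v i) x < 1) → x ≠ 0 →
        ∑ i, Real.log (1 - cross (polarCycle v i) x) < 0 := by
  have h0 : ∀ i, cross (polarCycle v i) 0 < 1 := fun i => by
    rw [map_zero]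
    exact one_pos
  rw [IsSantaloPointAtInfinity, h.interior_convexHull]
  refine (and_iff_right h0).trans (forall₂_congr fun x hx => imp_congr_right fun _ => ?_)
  simp only [h.secondTermAt_convexHull h0, h.secondTermAt_convexHull hx, map_zero, sub_zero,
    Real.log_one, Finset.sum_const_zero]
  rw [lt_sub_comm, sub_self]

lemma isSantaloPointAtInfinity_zero_iff (h : IsConvexCycle v) :
    IsSantaloPointAtInfinity (convexHull ℝ (range v)) 0 ↔ ∑ i, polarCycle v i = 0 := by
  rw [h.isSantaloPointAtInfinity_zero_iff_forall]
  refine ⟨fun hneg => eq_zero_of_forall_cross_eq_zero fun y => ?_, fun hsum x hx hx0 => ?_⟩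
  · have hmax : IsLocalMax (fun t : ℝ => ∑ i, Real.log (1 - t * cross (polarCycle v i) y)) 0 := by
      have hev : ∀ᶠ t in 𝓝 (0 : ℝ), ∀ i, t * cross (polarCycle v i) y < 1 :=
        eventually_all.mpr fun i =>
          ((continuous_mul_const _).tendsto' 0 0 (zero_mul _)).eventually_lt_const one_pos
      filter_upwards [hev] with t ht
      by_cases hy : t • y = 0
      · simp only [← smul_eq_mul, ← map_smul, hy, zero_smul, le_refl, map_zero]
      · have hlt := hneg (t • y) (by simpa only [map_smul, smul_eq_mul] using ht) hy
        simpa only [zero_mul, sub_zero, Real.log_one, Finset.sum_const_zero, map_smul,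
          smul_eq_mul] using hlt.le
    rw [map_sum, sum_apply]
    exact neg_eq_zero.mp (hmax.hasDerivAt_eq_zero (hasDerivAt_sum_log_one_sub _))
  · refine sum_log_one_sub_neg hx ?_ fun hzero => hx0 ?_
    · rw [← sum_apply, ← map_sum, hsum, map_zero, zero_apply]
    · refine eq_of_cross_eq (h.polarArea_ne 0) ?_ ?_ <;>
        rw [cross_swap, congrFun hzero, Pi.zero_apply, neg_zero, map_zero, zero_apply]

end IsConvexCycle

lemma mem_polygons_iff (hm : 3 ≤ m) {P : Set Plane} :
    P ∈ polygons m ↔ ∃ v : Fin m → Plane, IsConvexCycle v ∧ P = convexHull ℝ (range v) := by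
  simp only [polygons, mem_ofPred_eq, isVertexCycle_iff hm]

lemma convexHull_comp_regularCycle_mem_polygons (hm : 3 ≤ m) (g : Plane ≃ₗ[ℝ] Plane) :
    convexHull ℝ (range (g ∘ regularCycle m)) ∈ polygons m :=
  (mem_polygons_iff hm).mpr ⟨_, (isConvexCycle_regularCycle hm).comp g, rfl⟩

lemma secondTerm_comp_regularCycle (hm : 3 ≤ m) (g : Plane ≃ₗ[ℝ] Plane) :
    secondTerm (convexHull ℝ (range (g ∘ regularCycle m))) = areaFunctional (regularCycle m) :=
  ((isConvexCycle_regularCycle hm).comp g).secondTerm_convexHull.trans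
    ((isConvexCycle_regularCycle hm).areaFunctional_comp g)

lemma isSantaloPointAtInfinity_comp_regularCycle (hm : 3 ≤ m) (g : Plane ≃ₗ[ℝ] Plane) :
    IsSantaloPointAtInfinity (convexHull ℝ (range (g ∘ regularCycle m))) 0 := by
  rw [((isConvexCycle_regularCycle hm).comp g).isSantaloPointAtInfinity_zero_iff]
  exact sum_polarCycle_eq_zero fun i => by
    rw [← g.coe_coe, edgeArea_comp, edgeArea_regularCycle]

namespace IsConvexCycle

lemma secondTerm_le_regularCycle (h : IsConvexCycle v)
    (hs : IsSantaloPointAtInfinity (convexHull ℝ (range v)) 0) :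
    secondTerm (convexHull ℝ (range v)) ≤ areaFunctional (regularCycle m) := by
  rw [h.secondTerm_convexHull, ← h.areaFunctional_polarCycle]
  exact h.polar.areaFunctional_le_regularCycle (h.isSantaloPointAtInfinity_zero_iff.mp hs)

lemma isEquiareal_of_polarCycle (h : IsConvexCycle v) (hv : IsEquiareal (polarCycle v)) :
    IsEquiareal v := by
  obtain ⟨⟨E, hE⟩, D, hD⟩ := hv
  exact ⟨⟨D, fun i => (h.polarArea_polarCycle i).symm.trans (hD i)⟩,
    E, fun i => (edgeArea_polarCycle_pred v i).symm.trans (hE _)⟩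

lemma isEquiareal_of_regularCycle_le_secondTerm (h : IsConvexCycle v)
    (hs : IsSantaloPointAtInfinity (convexHull ℝ (range v)) 0)
    (hle : areaFunctional (regularCycle m) ≤ secondTerm (convexHull ℝ (range v))) :
    IsEquiareal v := by
  rw [h.secondTerm_convexHull, ← h.areaFunctional_polarCycle] at hle
  exact h.isEquiareal_of_polarCycle
    (h.polar.isEquiareal_of_regularCycle_le (h.isSantaloPointAtInfinity_zero_iff.mp hs) hle)

end IsConvexCycle

end Cycle

lemma isLinearImageOfRegular_iff {m : ℕ} {P : Set Plane} :
    IsLinearImageOfRegular m P ↔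
      ∃ g : Plane ≃ₗ[ℝ] Plane, P = convexHull ℝ (range (g ∘ regularCycle m)) := by
  refine exists_congr fun g => ?_
  rw [range_comp, ← g.coe_coe, ← LinearMap.image_convexHull]
  rfl

end CyclicPolygon

open CyclicPolygon

theorem theorem1p6 (m : ℕ) (hm : 3 ≤ m) :
    (∀ P ∈ polygons m, IsStationaryAt m P → IsLinearImageOfRegular m P) ∧
    (∀ P : Set Plane,
      (P ∈ polygons m ∧ IsSantaloPointAtInfinity P 0 ∧
        ∀ Q ∈ polygons m, IsSantaloPointAtInfinity Q 0 → secondTerm Q ≤ secondTerm P) ↔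
      IsLinearImageOfRegular m P) := by
  have : NeZero m := ⟨by lia⟩
  simp only [isLinearImageOfRegular_iff]
  refine ⟨?_, fun P => ⟨?_, ?_⟩⟩
  · rintro P - ⟨v, hv, rfl, hstationary⟩
    have h := (isVertexCycle_iff hm).mp hv
    obtain ⟨g, rfl⟩ := h.exists_eq_comp_regularCycle (h.isEquiareal_of_hasFDerivAt hstationary)
    exact ⟨g, rfl⟩
  · rintro ⟨hP, hs, hmax⟩
    obtain ⟨v, h, rfl⟩ := (mem_polygons_iff hm).mp hP
    have hge := hmax _ (convexHull_comp_regularCycle_mem_polygons hm (.refl ℝ Plane))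
      (isSantaloPointAtInfinity_comp_regularCycle hm _)
    rw [secondTerm_comp_regularCycle hm] at hge
    obtain ⟨g, rfl⟩ := h.exists_eq_comp_regularCycle
      (h.isEquiareal_of_regularCycle_le_secondTerm hs hge)
    exact ⟨g, rfl⟩
  · rintro ⟨g, rfl⟩
    refine ⟨convexHull_comp_regularCycle_mem_polygons hm g,
      isSantaloPointAtInfinity_comp_regularCycle hm g, fun Q hQ hs => ?_⟩
    obtain ⟨w, h, rfl⟩ := (mem_polygons_iff hm).mp hQ
    exact (h.secondTerm_le_regularCycle hs).trans_eq (secondTerm_comp_regularCycle hm g).symm
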